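/- Let $r=p/q$ be a rational function, with $p,q\in\mathbb C[z]$ coprime, $p$ non-constant and $\deg q\le\deg p=:N$. Let $w_1,\dots,w_L$ be the distinct zeros of $r$ and let $D_1,\dots,D_L$ be pairwise disjoint open disks with $w_\ell\in D_\ell$, such that no $\overline{D_\ell}$ contains a pole of $r$ and such that, with $\rho=\min\{|r(s)| : s\in\bigcup_\ell\partial D_\ell\}$, $$\{z\in\mathbb C : |r(z)|<\rho\}\subset\bigcup_{\ell=1}^L D_\ell .$$ Put $A(r)=\mathbb C\setminus\bigcup_{\ell=1}^L r(\partial D_\ell)$, let $r^{-1}(A(r))$ be the set of all $z\in\mathbb C$ that are not poles of $r$ and satisfy $r(z)\in A(r)$, and let $\Omega(r)$ be the set of $\alpha\in\mathbb C$ for which $r(z)=\alpha$ has $N$ pairwise different roots in $\mathbb C$. For $\alpha\in\Omega(r)\cap A(r)$, with roots $w_1(\alpha),\dots,w_N(\alpha)$ of $r(z)=\alpha$, and $f$ a $\mathbb C^m$-valued function analytic in $r^{-1}(A(r))$, put $$(R^{(r)}_\alpha f)(z)=\frac{f(z)}{r(z)-\alpha}-\sum_{n=1}^N\frac{f(w_n(\alpha))}{r'(w_n(\alpha))\,(z-w_n(\alpha))},\qquad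 z\in r^{-1}(A(r)),\ r(z)\ne\alpha,$$ extended by continuity to the points of $r^{-1}\{\alpha\}$. Let $\mathfrak L(r)$ be the linear span of the functions $z\mapsto\frac{r(z)-r(a)}{z-a}$, $a$ running through the points of $\mathbb C$ that are not poles of $r$; it has dimension $N$. Fix a basis $e_1,\dots,e_N$ of it and set $Z_r(z)=(e_1(z)\ \cdots\ e_N(z))$. Let $\mathfrak P$ be a reproducing kernel Pontryagin space (with finite negative index) of $\mathbb C^m$-valued functions analytic in $r^{-1}(A(r))$, with inner product $[\cdot,\cdot]$ and reproducing kernel $K(z,w)$. Assume that $R^{(r)}_\alpha\mathfrak P\subset\mathfrak P$ for every $\alpha\in\Omega(r)\cap A(r)$, and that $$[f,R^{(r)}_\beta g]-[R^{(r)}_\alpha f,g]+(\alpha-\overline\beta)\,[R^{(r)}_\alpha f,R^{(r)}_\beta g]=0$$ for all $\alpha,\beta\in\Omega(r)\cap A(r)$ and all $f,g\in\mathfrak P$. (a) Suppose that one of the following holds: $\deg p>\deg q$; or $r(\infty)\notin A(r)$; or every $f\in\mathfrak P$ satisfies $f(z)\to0$ as $|z|\to\infty$. Then there is a $\mathbb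 C^{Nm\times Nm}$-valued function $\mathsf N$ analytic in $A(r)$ such that $$K(z,w)=(Z_r(z)\otimes I_m)\,\frac{\mathsf N(r(z))-\mathsf N(r(w))^*}{r(z)-\overline{r(w)}}\,(Z_r(w)\otimes I_m)^*,\qquad z,w\in r^{-1}(A(r)),$$ where the quotient is understood as $\mathsf N'(r(z))$ when $r(z)=\overline{r(w)}$. (b) In the remaining case ($\deg p=\deg q$, $r(\infty)\in A(r)$ and some element of $\mathfrak P$ does not tend to $0$ at infinity) there is such a function $\mathsf N$ analytic in $A(r)\setminus\{r(\infty)\}$, and the same formula holds for all $z,w\in r^{-1}(A(r))$ with $r(z)\neq r(\infty)$ and $r(w)\ne r(\infty)$. -/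

import Mathlib

open Filter Topology
open scoped ComplexConjugate Matrix

noncomputable section

namespace RatResolvent

/-! ### Rational functions: values, poles, fibres, the state space

A rational function `r = p / q` in lowest terms is an element of `RatFunc ℂ`, with `p = r.num` and
`q = r.denom` (coprime, `q` monic). -/

/-- The value `r(z)`, meaningful when `z` is not a pole of `r`. -/
def val (r : RatFunc ℂ) (z : ℂ) : ℂ := r.eval (RingHom.id ℂ) z

/-- `z ∈ ℂ` is a regular point of `r`, that is, not a pole. -/
def IsRegularAt (r : RatFunc ℂ) (z : ℂ) : Prop := r.denom.eval z ≠ 0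

/-- `N = deg p`. -/
def deg (r : RatFunc ℂ) : ℕ := r.num.natDegree

/-- The fibre `r⁻¹{α}`: the roots in `ℂ` of the equation `r(z) = α`. -/
def fiber (r : RatFunc ℂ) (α : ℂ) : Set ℂ := {w | IsRegularAt r w ∧ val r w = α}

/-- `Ω(r)`: the `α ∈ ℂ` for which `r(z) = α` has `N` pairwise different roots. -/
def Omega (r : RatFunc ℂ) : Set ℂ := {α | (fiber r α).Finite ∧ (fiber r α).ncard = deg r}

/-- The value `c = r(∞)` is a finite number (for `deg q ≤ deg p`): this happens when
`deg p = deg q`, and then `c` is the quotient of the leading coefficients. -/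
def HasValueAtInfinity (r : RatFunc ℂ) (c : ℂ) : Prop :=
  r.num.natDegree = r.denom.natDegree ∧ c = r.num.leadingCoeff / r.denom.leadingCoeff

/-- The state space `𝔏(r)`: the linear span of the rational functions `(r(z) - r(a)) / (z - a)`,
where `a` runs through the points of analyticity of `r`. -/
def stateSpace (r : RatFunc ℂ) : Submodule ℂ (RatFunc ℂ) :=
  Submodule.span ℂ
    {g | ∃ a : ℂ, IsRegularAt r a ∧ g = (r - RatFunc.C (val r a)) / (RatFunc.X - RatFunc.C a)}

/-- The `p × Np` matrix `Z_r(z) ⊗ I_p`, where `Z_r(z) = (e₁(z), …, e_N(z))` is built from a basis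
`e₁, …, e_N` of the state space. -/
def Z {r : RatFunc ℂ} (e : Module.Basis (Fin (deg r)) ℂ (stateSpace r)) (p : ℕ) (z : ℂ) :
    Matrix (Fin p) (Fin (deg r) × Fin p) ℂ :=
  Matrix.of fun i nj => if i = nj.2 then val (e nj.1 : RatFunc ℂ) z else 0

/-! ### The disks and the sets they determine -/

/-- `D_ℓ = B(c_ℓ, R_ℓ)`, `ℓ = 1, …, L`, are pairwise disjoint open disks around the distinct zeros
`w₁, …, w_L` of `r`, such that neither the disks nor their boundaries contain poles of `r`, and
such that, with `ρ = min |r|` over the union of the boundary circles,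
`{z : |r(z)| < ρ} ⊆ D₁ ∪ ⋯ ∪ D_L`. -/
structure AdmissibleDisks (r : RatFunc ℂ) {L : ℕ} (w c : Fin L → ℂ) (R : Fin L → ℝ) : Prop where
  injective : Function.Injective w
  range_eq : Set.range w = fiber r 0
  radius_pos : ∀ l, 0 < R l
  mem_ball : ∀ l, w l ∈ Metric.ball (c l) (R l)
  disjoint : Pairwise fun l m => Disjoint (Metric.ball (c l) (R l)) (Metric.ball (c m) (R m))
  regular : ∀ l, ∀ s ∈ Metric.closedBall (c l) (R l), IsRegularAt r s
  sublevel : ∀ z, IsRegularAt r z →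
    ‖val r z‖ < sInf ((fun s => ‖val r s‖) '' ⋃ l, Metric.sphere (c l) (R l)) →
    z ∈ ⋃ l, Metric.ball (c l) (R l)

/-- `A(r) = ℂ \ ⋃ r(∂D_ℓ)`. -/
def A (r : RatFunc ℂ) {L : ℕ} (c : Fin L → ℂ) (R : Fin L → ℝ) : Set ℂ :=
  (⋃ l, val r '' Metric.sphere (c l) (R l))ᶜ

/-- The inverse image `r⁻¹(A)` of a subset `A` of `ℂ`. -/
def preimage (r : RatFunc ℂ) (A : Set ℂ) : Set ℂ := {z | IsRegularAt r z ∧ val r z ∈ A}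

/-! ### Functions on a subset of `ℂ` and the resolvent operators -/

/-- Extension by zero; an auxiliary device, its values outside `D` never matter below. -/
def zeroExt {D : Set ℂ} {p : ℕ} (f : D → Fin p → ℂ) : ℂ → Fin p → ℂ :=
  Function.extend Subtype.val f 0

/-- `f : D → ℂᵖ` is analytic (for `D` open in `ℂ`). -/
def IsAnalytic {D : Set ℂ} {p : ℕ} (f : D → Fin p → ℂ) : Prop :=
  AnalyticOnNhd ℂ (zeroExt f) D

/-- `f(z) / (r(z) - α) - ∑ₙ f(wₙ) / (r'(wₙ) (z - wₙ))`, the sum being over the roots `wₙ` of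
`r(w) = α`. -/
def resolventFormula (r : RatFunc ℂ) (α : ℂ) {p : ℕ} (f : ℂ → Fin p → ℂ) (z : ℂ) : Fin p → ℂ :=
  (val r z - α)⁻¹ • f z - ∑ᶠ w ∈ fiber r α, (deriv (val r) w * (z - w))⁻¹ • f w

/-- The operator `R_α^{(r)}`: the formula above where `r(z) ≠ α`, and its continuous (hence, for
analytic `f`, analytic) extension at the points of `r⁻¹{α}`. -/
def resolvent (r : RatFunc ℂ) (α : ℂ) {D : Set ℂ} {p : ℕ} (f : D → Fin p → ℂ) :
    D → Fin p → ℂ := fun z =>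
  if val r z = α then limUnder (𝓝[≠] (z : ℂ)) (resolventFormula r α (zeroExt f))
  else resolventFormula r α (zeroExt f) z

/-! ### Pontryagin spaces and reproducing kernels -/

/-- `(V, [·,·])` is a Pontryagin space: the form (linear in the first and conjugate linear in the
second variable) is Hermitian, and `V` is the direct and orthogonal sum of a subspace on which the
form is positive definite and complete (a Hilbert space) and a finite dimensional subspace on which
it is negative definite. -/
def IsPontryaginSpace {V : Type*} [AddCommGroup V] [Module ℂ V]
    (form : V →ₗ[ℂ] V →ₗ⋆[ℂ] ℂ) : Prop :=
  (∀ f g, form g f = conj (form f g)) ∧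
  ∃ Vp Vm : Submodule ℂ V, IsCompl Vp Vm ∧
    (∀ f ∈ Vp, ∀ g ∈ Vm, form f g = 0) ∧
    (∀ f ∈ Vp, f ≠ 0 → 0 < (form f f).re) ∧
    (∀ u : ℕ → V, (∀ n, u n ∈ Vp) →
      (∀ ε > 0, ∃ M, ∀ m ≥ M, ∀ n ≥ M, (form (u m - u n) (u m - u n)).re < ε) →
      ∃ f ∈ Vp, Tendsto (fun n => (form (u n - f) (u n - f)).re) atTop (𝓝 0)) ∧
    FiniteDimensional ℂ Vm ∧
    (∀ f ∈ Vm, f ≠ 0 → (form f f).re < 0)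

/-- `K` is the reproducing kernel of the space `P` of `ℂᵖ`-valued functions on `D`, with form
`[·,·]`: for `w ∈ D` and `d ∈ ℂᵖ` the function `K(·, w) d` belongs to `P`, and
`[f, K(·, w) d] = d^* f(w)` for every `f ∈ P`. -/
def IsReproducingKernel {D : Set ℂ} {p : ℕ} (P : Submodule ℂ (D → Fin p → ℂ))
    (form : P →ₗ[ℂ] P →ₗ⋆[ℂ] ℂ) (K : D → D → Matrix (Fin p) (Fin p) ℂ) : Prop :=
  ∀ (w : D) (d : Fin p → ℂ), ∃ h : (fun z => K z w *ᵥ d) ∈ P,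
    ∀ f : P, form f ⟨fun z => K z w *ᵥ d, h⟩ = star d ⬝ᵥ (f : D → Fin p → ℂ) w

/-- A matrix valued function is analytic at every point of `U`. -/
def MatrixAnalyticOn {m : Type*} (N : ℂ → Matrix m m ℂ) (U : Set ℂ) : Prop :=
  ∀ i j, AnalyticOnNhd ℂ (fun u => N u i j) U

/-- The kernel `(N(u) - N(v)^*) / (u - conj v)`, understood as the limit `N'(u)` when
`u = conj v`. -/
def nevanlinnaKernel {m : Type*} (N : ℂ → Matrix m m ℂ) (u v : ℂ) : Matrix m m ℂ :=
  if u = conj v then Matrix.of fun i j => deriv (fun t => N t i j) u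
  else (u - conj v)⁻¹ • (N u - (N v)ᴴ)

end RatResolvent

end

open RatResolvent

namespace RatResolvent

open Polynomial

/-! Fix one real α in Ω(r) ∩ A(r); the complement of this set is bounded, so large real numbers
qualify. For α = β real the structure identity says that the resolvent at α is symmetric. Applied to
two kernel columns and multiplied by (r(ζ) - α) conj(r(z) - α), this symmetry reads (r(ζ) - conj
r(z)) K(ζ,z) = ∑ₙ Fₙ(ζ) ℓₙ(z)^* - ∑ₙ ℓₙ(ζ) Fₙ(z)^*, with Fₙ(ζ) = (r(ζ) - α) K(ζ,wₙ) and ℓₙ(z) =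
(r(z) - α) / (r'(wₙ)(z - wₙ)), the wₙ being the roots of r = α. Each ℓₙ lies in the state space,
with constant coordinates tₙ. If also Fₙ = Z_r · Gₙ(r) with Gₙ analytic, then N = ∑ₙ Gₙ tₙ^* is the
required numerator (`exists_kernel_numerator`).

The analytic core is therefore `exists_coordinates`. Dividing p(x)q(z) - p(z)q(x) by x - z gives
(r(x) - r(z))/(x - z) = ∑ₘ eₘ(z) cₘ(x)/q(x). On the fibre r(z) = u this expands the Cauchy kernel
1/(x - z) in the eₘ(z), with coefficients cₘ(x)/(q(x)(r(x) - u)). Cauchy's formula on small circles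
around a fibre then yields coordinates analytic in u. Near u = r(∞) some roots escape to infinity; a
Cauchy integral in 1/z accounts for them, provided the function vanishes at infinity. This is the
origin of the distinction between (a) and (b).

It remains to reach the fibre of α by continuity (`kernel_identity_extend`), to see that N(u) =
N(conj u)^* (`numerator_symm`), and to divide by r(z) - conj r(w), with a limit where this vanishes
(`kernel_eq_of_identity`). -/

/-- The polynomial `p - u q`, whose roots form the fibre over `u` of `r = p / q`. -/
noncomputable def pencil (r : RatFunc ℂ) (u : ℂ) : ℂ[X] := r.num - C u * r.denom

/-! ### Fibres as root sets of the pencil p - u q. -/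

lemma val_eq (r : RatFunc ℂ) (z : ℂ) : val r z = r.num.eval z / r.denom.eval z := by
  simp [val, RatFunc.eval, Polynomial.eval₂_id]

lemma eval_pencil (r : RatFunc ℂ) (u z : ℂ) :
    (pencil r u).eval z = r.num.eval z - u * r.denom.eval z := by
  simp [pencil]

lemma eval_pencil_of_regular {r : RatFunc ℂ} {z : ℂ} (hz : IsRegularAt r z) (u : ℂ) :
    (pencil r u).eval z = (val r z - u) * r.denom.eval z := by
  have : r.denom.eval z ≠ 0 := hz
  rw [eval_pencil, val_eq]
  field_simp

lemma isRegularAt_of_eval_pencil_eq_zero {r : RatFunc ℂ} {u z : ℂ}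
    (h : (pencil r u).eval z = 0) : IsRegularAt r z := by
  intro hq
  obtain ⟨a, b, hab⟩ := RatFunc.isCoprime_num_denom r
  have h1 := congrArg (Polynomial.eval z) hab
  rw [eval_pencil, hq] at h
  simp only [eval_add, eval_mul, hq, eval_one] at h1
  simp only [mul_zero, sub_zero] at h
  simp [h] at h1

lemma mem_fiber_iff {r : RatFunc ℂ} {u z : ℂ} : z ∈ fiber r u ↔ (pencil r u).eval z = 0 := by
  constructor
  · rintro ⟨h1, h2⟩
    rw [eval_pencil_of_regular h1, h2, sub_self, zero_mul]
  · intro h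
    have h1 := isRegularAt_of_eval_pencil_eq_zero h
    refine ⟨h1, ?_⟩
    rw [eval_pencil_of_regular h1] at h
    exact sub_eq_zero.mp ((mul_eq_zero.mp h).resolve_right h1)

/-- For coprime polynomials a zero Wronskian forces both derivatives to vanish, so p would be
constant. -/
lemma wronskian_ne_zero {r : RatFunc ℂ} (hnum : 1 ≤ r.num.natDegree) :
    wronskian r.num r.denom ≠ 0 := by
  intro h
  have h1 := ((RatFunc.isCoprime_num_denom r).wronskian_eq_zero_iff.mp h).1
  have := derivative_eq_zero.mp h1
  omega

lemma pencil_ne_zero {r : RatFunc ℂ} (hnum : 1 ≤ r.num.natDegree) (u : ℂ) : pencil r u ≠ 0 := by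
  intro h
  apply wronskian_ne_zero hnum
  have : r.num = C u * r.denom := sub_eq_zero.mp h
  rw [this, wronskian]
  simp only [derivative_mul, derivative_C]
  ring

lemma natDegree_pencil_le {r : RatFunc ℂ} (hdeg : r.denom.natDegree ≤ r.num.natDegree) (u : ℂ) :
    (pencil r u).natDegree ≤ deg r :=
  (natDegree_sub_le _ _).trans
    (max_le le_rfl ((natDegree_C_mul_le _ _).trans hdeg))

lemma natDegree_pencil {r : RatFunc ℂ} (hdeg : r.denom.natDegree ≤ r.num.natDegree)
    (hnum : 1 ≤ r.num.natDegree) {u : ℂ} (hu : ¬ HasValueAtInfinity r u) :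
    (pencil r u).natDegree = deg r := by
  refine le_antisymm (natDegree_pencil_le hdeg u) (le_natDegree_of_ne_zero ?_)
  rw [pencil, coeff_sub, coeff_C_mul, deg, coeff_natDegree]
  have hp : r.num.leadingCoeff ≠ 0 := by
    rw [Ne, leadingCoeff_eq_zero]
    rintro h
    simp [h] at hnum
  rcases hdeg.lt_or_eq with h | h
  · simpa [coeff_eq_zero_of_natDegree_lt h] using hp
  · intro h0
    apply hu
    refine ⟨h.symm, ?_⟩
    have hq : r.denom.leadingCoeff ≠ 0 := leadingCoeff_ne_zero.mpr r.denom_ne_zero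
    rw [← h, coeff_natDegree] at h0
    field_simp
    linear_combination -h0

lemma finite_fiber {r : RatFunc ℂ} (hnum : 1 ≤ r.num.natDegree) (u : ℂ) :
    (fiber r u).Finite := by
  refine (pencil r u).roots.toFinset.finite_toSet.subset fun z hz => ?_
  simpa [pencil_ne_zero hnum u] using mem_fiber_iff.mp hz

lemma mem_Omega_of_nodup {r : RatFunc ℂ} (hnum : 1 ≤ r.num.natDegree)
    (hdeg : r.denom.natDegree ≤ r.num.natDegree) {u : ℂ} (hu : ¬ HasValueAtInfinity r u)
    (h : (pencil r u).roots.Nodup) : u ∈ Omega r := by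
  refine ⟨finite_fiber hnum u, ?_⟩
  have : fiber r u = (pencil r u).roots.toFinset := by
    ext z
    simp [mem_fiber_iff, pencil_ne_zero hnum u]
  rw [this, Set.ncard_coe_finset, Multiset.toFinset_card_of_nodup h,
    ← natDegree_pencil hdeg hnum hu]
  exact (IsAlgClosed.splits _).natDegree_eq_card_roots.symm

/-- Apart from r(∞), a value is missed by Ω(r) only if its pencil has a multiple root. The Wronskian
of p and q vanishes there, so the value is one of finitely many critical values. -/
lemma finite_compl_Omega {r : RatFunc ℂ} (hnum : 1 ≤ r.num.natDegree)
    (hdeg : r.denom.natDegree ≤ r.num.natDegree) : (Omega r)ᶜ.Finite := by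
  have hW := wronskian_ne_zero hnum
  refine (((wronskian r.num r.denom).roots.toFinset.finite_toSet.image (val r)).union
    (Set.finite_singleton (r.num.leadingCoeff / r.denom.leadingCoeff))).subset fun u hu => ?_
  by_cases hu' : HasValueAtInfinity r u
  · exact Or.inr hu'.2
  · left
    by_contra hn
    apply hu
    refine mem_Omega_of_nodup hnum hdeg hu' ?_
    rw [Multiset.nodup_iff_count_le_one]
    intro z
    rw [count_roots]
    by_contra hlt
    have h2 := (one_lt_rootMultiplicity_iff_isRoot (pencil_ne_zero hnum u)).mp (not_le.mp hlt)
    have hz := mem_fiber_iff.mpr h2.1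
    apply hn
    refine ⟨z, ?_, hz.2⟩
    have h3 : r.num.eval z - u * r.denom.eval z = 0 := by
      rw [← eval_pencil]; exact h2.1
    have h4 : r.num.derivative.eval z - u * r.denom.derivative.eval z = 0 := by
      have := h2.2
      simpa [pencil, IsRoot] using this
    rw [Finset.mem_coe, Multiset.mem_toFinset, mem_roots hW, IsRoot, wronskian, eval_sub,
      eval_mul, eval_mul]
    linear_combination r.denom.derivative.eval z * h3 - r.denom.eval z * h4

lemma natDegree_pencil_lt {r : RatFunc ℂ} (hnum : 1 ≤ r.num.natDegree) {u : ℂ}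
    (hu : HasValueAtInfinity r u) : (pencil r u).natDegree < deg r := by
  obtain ⟨h1, h2⟩ := hu
  have hq : r.denom.leadingCoeff ≠ 0 := leadingCoeff_ne_zero.mpr r.denom_ne_zero
  refine lt_of_le_of_ne (natDegree_pencil_le h1.ge u) fun h => ?_
  have h3 : (pencil r u).coeff (deg r) = 0 := by
    rw [pencil, coeff_sub, coeff_C_mul, deg, coeff_natDegree, h1, coeff_natDegree, h2]
    field_simp
    simp
  rw [← h, coeff_natDegree, leadingCoeff_eq_zero] at h3
  exact pencil_ne_zero hnum u h3

/-! ### The state space as fractions s / q with deg s < N, and the Bezoutian. -/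

/-- A polynomial of degree less than `N` vanishing on a fibre with `N` points is zero. -/
lemma eq_zero_of_fiber {r : RatFunc ℂ} {u : ℂ} (hu : u ∈ Omega r) {s : ℂ[X]}
    (hs : s.degree < deg r) (h : ∀ z ∈ fiber r u, s.eval z = 0) : s = 0 := by
  refine eq_zero_of_degree_lt_of_eval_finset_eq_zero hu.1.toFinset ?_ ?_
  · rw [← Set.ncard_eq_toFinset_card _ hu.1, hu.2]
    exact hs
  · intro z hz
    exact h z (hu.1.mem_toFinset.mp hz)

/-- For a generator, s is the quotient of the pencil at r(a) by X - a; this division lowers the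
degree below N. -/
lemma exists_numerator {r : RatFunc ℂ} (hnum : 1 ≤ r.num.natDegree)
    (hdeg : r.denom.natDegree ≤ r.num.natDegree) {E : RatFunc ℂ} (hE : E ∈ stateSpace r) :
    ∃ s : ℂ[X], s.degree < deg r ∧
      E = algebraMap ℂ[X] (RatFunc ℂ) s / algebraMap ℂ[X] (RatFunc ℂ) r.denom := by
  have hq : algebraMap ℂ[X] (RatFunc ℂ) r.denom ≠ 0 := by
    simpa using r.denom_ne_zero
  induction hE using Submodule.span_induction with
  | mem E hE =>
    obtain ⟨a, ha, rfl⟩ := hE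
    have hroot : (pencil r (val r a)).IsRoot a := by
      rw [IsRoot, ← mem_fiber_iff]; exact ⟨ha, rfl⟩
    obtain ⟨s, hs⟩ := dvd_iff_isRoot.mpr hroot
    refine ⟨s, ?_, ?_⟩
    · have h0 := pencil_ne_zero hnum (val r a)
      have hs0 : s ≠ 0 := by
        rintro rfl
        exact h0 (by rw [hs, mul_zero])
      rw [degree_eq_natDegree hs0]
      have := natDegree_pencil_le hdeg (val r a)
      rw [hs, natDegree_mul (X_sub_C_ne_zero a) hs0, natDegree_X_sub_C] at this
      exact_mod_cast (by omega : s.natDegree < deg r)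
    · have hX : (RatFunc.X : RatFunc ℂ) - RatFunc.C a ≠ 0 := by
        have := X_sub_C_ne_zero a
        intro h
        apply this
        apply RatFunc.algebraMap_injective ℂ
        simpa using h
      have h1 := congrArg (algebraMap ℂ[X] (RatFunc ℂ)) hs
      simp only [pencil, map_sub, map_mul, RatFunc.algebraMap_X, RatFunc.algebraMap_C] at h1
      rw [div_eq_div_iff hX hq, mul_comm _ (RatFunc.X - RatFunc.C a), ← h1, sub_mul]
      congr 1
      nth_rewrite 1 [← RatFunc.num_div_denom r]
      rw [div_mul_cancel₀ _ hq]
  | zero => exact ⟨0, by simp, by simp⟩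
  | add E F _ _ h1 h2 =>
    obtain ⟨s, hs, rfl⟩ := h1
    obtain ⟨t, ht, rfl⟩ := h2
    exact ⟨s + t, (degree_add_le _ _).trans_lt (max_lt hs ht), by rw [map_add, add_div]⟩
  | smul a E _ h1 =>
    obtain ⟨s, hs, rfl⟩ := h1
    refine ⟨C a * s, (C_mul' a s ▸ degree_smul_le a s).trans_lt hs, ?_⟩
    rw [map_mul, RatFunc.algebraMap_C, RatFunc.smul_eq_C_mul, mul_div_assoc]

/-- `val` evaluates the reduced fraction, so cancellation must be controlled: the reduced
denominator divides q and does not vanish at z. -/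
lemma val_div_denom {r : RatFunc ℂ} {z : ℂ} (hz : IsRegularAt r z) (s : ℂ[X]) :
    val (algebraMap ℂ[X] (RatFunc ℂ) s / algebraMap ℂ[X] (RatFunc ℂ) r.denom) z
      = s.eval z / r.denom.eval z := by
  set E := algebraMap ℂ[X] (RatFunc ℂ) s / algebraMap ℂ[X] (RatFunc ℂ) r.denom with hE
  have hq : algebraMap ℂ[X] (RatFunc ℂ) r.denom ≠ 0 := by
    simpa using r.denom_ne_zero
  have hz' : r.denom.eval z ≠ 0 := hz
  have h1 : E.denom.eval z ≠ 0 := by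
    obtain ⟨t, ht⟩ := RatFunc.denom_div_dvd s r.denom
    intro h
    apply hz'
    rw [ht, eval_mul, h, zero_mul]
  have hm : E * algebraMap ℂ[X] (RatFunc ℂ) r.denom = algebraMap ℂ[X] (RatFunc ℂ) s := by
    rw [hE]; field_simp
  have h2 := RatFunc.eval_mul (RingHom.id ℂ) z (x := E)
    (y := algebraMap ℂ[X] (RatFunc ℂ) r.denom) (by simpa [Polynomial.eval₂_id] using h1) (by simp)
  rw [hm] at h2
  simp only [RatFunc.eval_algebraMap, Algebra.algebraMap_self, RingHom.id_apply,
    Polynomial.eval₂_id] at h2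
  rw [eq_div_iff hz', h2, val]

/-- The polynomial kernel `(p(x) q(z) - p(z) q(x)) / (x - z)` as a polynomial in `z`. -/
lemma exists_bezoutian {p q : ℂ[X]} {N : ℕ} (hN : 1 ≤ N) (hp : p.natDegree ≤ N)
    (hq : q.natDegree ≤ N) :
    ∃ Q : ℂ[X][X], Q.natDegree < N ∧ ∀ x z : ℂ,
      p.eval x * q.eval z - p.eval z * q.eval x = (x - z) * ∑ j ∈ Finset.range N,
        z ^ j * (Q.coeff j).eval x := by
  -- The outer variable plays z and the coefficients are polynomials in x. Vanishing on the diagonal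
  -- z = x is the root `X`.
  set F : ℂ[X][X] := C q * p.map C - C p * q.map C with hF
  have hroot : F.IsRoot X := by
    have h1 : ∀ f : ℂ[X], (f.map C).eval X = f := fun f => by
      rw [eval_map, ← Polynomial.eval₂_C_X (p := f)]
      simp [Polynomial.eval₂_C_X]
    simp [hF, h1, mul_comm]
  obtain ⟨Q, hQ⟩ := dvd_iff_isRoot.mpr hroot
  have hdF : F.natDegree ≤ N := by
    refine (natDegree_sub_le _ _).trans (max_le ?_ ?_)
    all_goals refine (natDegree_C_mul_le _ _).trans (natDegree_map_le.trans ?_); assumption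
  have hdQ : Q.natDegree < N := by
    by_cases hQ0 : Q = 0
    · rw [hQ0, natDegree_zero]; exact hN
    · rw [hQ, natDegree_mul (X_sub_C_ne_zero _) hQ0, natDegree_X_sub_C] at hdF
      omega
  refine ⟨Q, hdQ, fun x z => ?_⟩
  have h1 := congrArg (fun G : ℂ[X][X] => (G.map (evalRingHom x)).eval z) hQ
  have h2 : ∀ f : ℂ[X], (f.map C).map (evalRingHom x) = f := fun f => by
    rw [Polynomial.map_map]
    convert! Polynomial.map_id
    ext
    all_goals simp
  have h3 : (Q.map (evalRingHom x)).eval z =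
      ∑ j ∈ Finset.range N, z ^ j * (Q.coeff j).eval x := by
    rw [eval_eq_sum_range' (lt_of_le_of_lt natDegree_map_le hdQ)]
    simp [mul_comm]
  simp only [hF, Polynomial.map_sub, Polynomial.map_mul, Polynomial.map_C, h2, eval_sub,
    eval_mul, eval_C, Polynomial.map_X, eval_X, coe_evalRingHom, h3] at h1
  linear_combination -h1

/-- Numerators `s` of a basis of the state space, with dual polynomials `c` expressing
the difference quotient of `r`. -/
lemma exists_basis_numerators {r : RatFunc ℂ} (hnum : 1 ≤ r.num.natDegree)
    (hdeg : r.denom.natDegree ≤ r.num.natDegree)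
    (e : Module.Basis (Fin (deg r)) ℂ (stateSpace r)) :
    ∃ s c : Fin (deg r) → ℂ[X], (∀ m, (s m).degree < deg r) ∧
      (∀ m z, IsRegularAt r z → val (e m : RatFunc ℂ) z = (s m).eval z / r.denom.eval z) ∧
      LinearIndependent ℂ s ∧
      ∀ x z, r.num.eval x * r.denom.eval z - r.num.eval z * r.denom.eval x
        = (x - z) * ∑ m, (s m).eval z * (c m).eval x := by
  choose s hs hse using fun m => exists_numerator hnum hdeg (e m).2
  have hli : LinearIndependent ℂ s := by
    rw [Fintype.linearIndependent_iff]
    intro a ha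
    have h1 : ∑ m, a m • e m = 0 := by
      apply Subtype.ext
      simp only [AddSubmonoidClass.coe_finsetSum, Submodule.coe_smul, ZeroMemClass.coe_zero]
      have h2 := congrArg (algebraMap ℂ[X] (RatFunc ℂ)) ha
      simp only [map_sum, map_zero] at h2
      calc ∑ m, a m • (e m : RatFunc ℂ)
          = (∑ m, algebraMap ℂ[X] (RatFunc ℂ) (a m • s m)) /
              algebraMap ℂ[X] (RatFunc ℂ) r.denom := by
            rw [Finset.sum_div]
            refine Finset.sum_congr rfl fun m _ => ?_
            rw [hse m, smul_eq_C_mul, map_mul, RatFunc.algebraMap_C, RatFunc.smul_eq_C_mul,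
              mul_div_assoc]
        _ = 0 := by rw [h2, zero_div]
    exact Fintype.linearIndependent_iff.mp e.linearIndependent a h1
  obtain ⟨Q, hQd, hQ⟩ := exists_bezoutian (N := deg r) hnum le_rfl hdeg
  let s' : Fin (deg r) → degreeLT ℂ (deg r) := fun m => ⟨s m, mem_degreeLT.mpr (hs m)⟩
  have hli' : LinearIndependent ℂ s' :=
    LinearIndependent.of_comp (degreeLT ℂ (deg r)).subtype hli
  have hfr : Module.finrank ℂ (degreeLT ℂ (deg r)) = deg r := by
    rw [(degreeLTEquiv ℂ (deg r)).finrank_eq]; simp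
  have : Nonempty (Fin (deg r)) := ⟨⟨0, hnum⟩⟩
  have : FiniteDimensional ℂ (degreeLT ℂ (deg r)) :=
    (degreeLTEquiv ℂ (deg r)).symm.finiteDimensional
  -- N independent numerators fill the N-dimensional space of polynomials of degree < N, so the
  -- powers of z in the Bezoutian can be re-expanded in them; collecting terms gives the dual
  -- polynomials `c`.
  let b := basisOfLinearIndependentOfCardEqFinrank hli' (by rw [hfr, Fintype.card_fin])
  have hb : ∀ m, b m = s' m := fun m => by simp [b]
  have hX : ∀ j : Fin (deg r), (X ^ (j : ℕ) : ℂ[X]) ∈ degreeLT ℂ (deg r) := fun j => by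
    rw [mem_degreeLT, degree_X_pow]
    exact_mod_cast j.2
  have hrepr : ∀ (j : Fin (deg r)) (z : ℂ),
      z ^ (j : ℕ) = ∑ m, b.repr ⟨X ^ (j : ℕ), hX j⟩ m * (s m).eval z := by
    intro j z
    have h1 := congrArg (fun f : degreeLT ℂ (deg r) => (f : ℂ[X]).eval z)
      (b.sum_repr ⟨X ^ (j : ℕ), hX j⟩)
    simp only [AddSubmonoidClass.coe_finsetSum, Submodule.coe_smul, hb, s', eval_finsetSum,
      eval_smul, smul_eq_mul, eval_pow, eval_X] at h1
    exact h1.symm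
  refine ⟨s, fun m => ∑ j : Fin (deg r), C (b.repr ⟨X ^ (j : ℕ), hX j⟩ m) * Q.coeff j, hs,
    fun m z hz => ?_, hli, fun x z => ?_⟩
  · rw [hse m, val_div_denom hz]
  · rw [hQ x z, Finset.sum_range]
    congr 1
    simp only [eval_finsetSum, eval_mul, eval_C, Finset.mul_sum]
    rw [Finset.sum_comm]
    refine Finset.sum_congr rfl fun j _ => ?_
    rw [hrepr j z, Finset.sum_mul]
    refine Finset.sum_congr rfl fun m _ => by ring

/-- Coordinates with respect to a basis of the state space are determined by the values on a
fibre over a point of `Ω(r)`. -/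
lemma eq_zero_of_sum_val_eq_zero {r : RatFunc ℂ} (hnum : 1 ≤ r.num.natDegree)
    (hdeg : r.denom.natDegree ≤ r.num.natDegree)
    (e : Module.Basis (Fin (deg r)) ℂ (stateSpace r)) {u : ℂ} (hu : u ∈ Omega r)
    {g : Fin (deg r) → ℂ}
    (h : ∀ z ∈ fiber r u, ∑ m, val (e m : RatFunc ℂ) z * g m = 0) : g = 0 := by
  obtain ⟨s, -, hs, hv, hli, -⟩ := exists_basis_numerators hnum hdeg e
  have h0 : ∑ m, g m • s m = 0 := by
    refine eq_zero_of_fiber hu ?_ fun z hz => ?_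
    · rw [← mem_degreeLT]
      exact Submodule.sum_mem _ fun m _ =>
        Submodule.smul_mem _ _ (mem_degreeLT.mpr (hs m))
    · have h1 := h z hz
      have hq : r.denom.eval z ≠ 0 := hz.1
      simp only [hv _ z hz.1] at h1
      rw [eval_finsetSum]
      simp only [eval_smul, smul_eq_mul]
      have h2 : ∑ m, g m * (s m).eval z =
          (∑ m, (s m).eval z / r.denom.eval z * g m) * r.denom.eval z := by
        rw [Finset.sum_mul]
        refine Finset.sum_congr rfl fun m _ => ?_
        field_simp
      rw [h2, h1, zero_mul]
  exact funext (Fintype.linearIndependent_iff.mp hli g h0)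

/-! ### Cauchy type integrals depending on a parameter -/

lemma eventually_forall_sphere_ne {ψ : ℂ → ℂ} {c : ℂ} {R : ℝ}
    (hψ : ContinuousOn ψ (Metric.sphere c R)) {u₀ : ℂ} (h : ∀ x ∈ Metric.sphere c R, ψ x ≠ u₀) :
    ∀ᶠ u in 𝓝 u₀, ∀ x ∈ Metric.sphere c R, ψ x ≠ u := by
  have hc : IsClosed (ψ '' Metric.sphere c R) :=
    ((isCompact_sphere c R).image_of_continuousOn hψ).isClosed
  have : (ψ '' Metric.sphere c R)ᶜ ∈ 𝓝 u₀ := hc.isOpen_compl.mem_nhds (by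
    rintro ⟨x, hx, rfl⟩
    exact h x hx rfl)
  filter_upwards [this] with u hu x hx hxu
  exact hu ⟨x, hx, hxu⟩

/-- Differentiation under the integral sign: ψ stays at distance at least δ/2 from every u near u₀,
which dominates the derivative of the integrand uniformly. -/
lemma differentiableAt_circleIntegral_div_sub {φ ψ : ℂ → ℂ} {c : ℂ} {R : ℝ} (hR : 0 ≤ R)
    (hφ : ContinuousOn φ (Metric.sphere c R)) (hψ : ContinuousOn ψ (Metric.sphere c R)) {u₀ : ℂ}
    (h : ∀ x ∈ Metric.sphere c R, ψ x ≠ u₀) :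
    DifferentiableAt ℂ (fun u => ∮ x in C(c, R), φ x / (ψ x - u)) u₀ := by
  obtain ⟨δ, hδ, hball⟩ := Metric.eventually_nhds_iff.mp (eventually_forall_sphere_ne hψ h)
  obtain ⟨M, hM⟩ := (isCompact_sphere c R).exists_bound_of_continuousOn hφ
  have hdist : ∀ x ∈ Metric.sphere c R, ∀ u ∈ Metric.ball u₀ (δ / 2), δ / 2 ≤ ‖ψ x - u‖ := by
    intro x hx u hu
    -- If ψ(x) were closer, `hball` could be applied to u = ψ(x) itself.
    have h1 : δ ≤ dist (ψ x) u₀ := by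
      by_contra hlt
      exact hball (not_le.mp hlt) x hx rfl
    have h2 := dist_triangle (ψ x) u u₀
    rw [Metric.mem_ball] at hu
    rw [← dist_eq_norm]
    linarith
  have hne : ∀ x ∈ Metric.sphere c R, ∀ u ∈ Metric.ball u₀ (δ / 2), ψ x - u ≠ 0 := by
    intro x hx u hu h0
    have := hdist x hx u hu
    rw [h0, norm_zero] at this
    linarith
  have hmem : ∀ t, circleMap c R t ∈ Metric.sphere c R := fun t => circleMap_mem_sphere c hR t
  have hφ' : Continuous fun t => φ (circleMap c R t) :=
    hφ.comp_continuous (continuous_circleMap c R) hmem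
  have hψ' : Continuous fun t => ψ (circleMap c R t) :=
    hψ.comp_continuous (continuous_circleMap c R) hmem
  have hd : Continuous fun t => deriv (circleMap c R) t := by
    simp only [deriv_circleMap]
    exact (continuous_circleMap 0 R).mul continuous_const
  have hF : ∀ u ∈ Metric.ball u₀ (δ / 2), Continuous fun t => deriv (circleMap c R) t •
      (φ (circleMap c R t) / (ψ (circleMap c R t) - u)) := fun u hu =>
    hd.smul (hφ'.div (hψ'.sub continuous_const) fun t => hne _ (hmem t) u hu)
  have hu₀ : u₀ ∈ Metric.ball u₀ (δ / 2) := Metric.mem_ball_self (by linarith)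
  have key := intervalIntegral.hasDerivAt_integral_of_dominated_loc_of_deriv_le
    (μ := MeasureTheory.volume) (a := 0) (b := 2 * Real.pi)
    (F := fun u t => deriv (circleMap c R) t •
      (φ (circleMap c R t) / (ψ (circleMap c R t) - u)))
    (F' := fun u t => deriv (circleMap c R) t •
      (φ (circleMap c R t) / (ψ (circleMap c R t) - u) ^ 2))
    (x₀ := u₀) (s := Metric.ball u₀ (δ / 2)) (bound := fun _ => R * (M / (δ / 2) ^ 2))
    (Metric.ball_mem_nhds _ (by linarith))
    (by
      filter_upwards [Metric.ball_mem_nhds u₀ (show 0 < δ / 2 by linarith)] with u hu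
      exact (hF u hu).aestronglyMeasurable)
    ((hF u₀ hu₀).intervalIntegrable _ _)
    ((hd.smul (hφ'.div ((hψ'.sub continuous_const).pow 2) fun t =>
      pow_ne_zero 2 (hne _ (hmem t) u₀ hu₀))).aestronglyMeasurable)
    (Eventually.of_forall fun t _ u hu => by
      rw [norm_smul, deriv_circleMap, norm_mul, norm_circleMap_zero, Complex.norm_I, mul_one,
        abs_of_nonneg hR, norm_div, norm_pow]
      have h1 := hM _ (hmem t)
      have h2 := hdist _ (hmem t) u hu
      have h3 : 0 ≤ M := (norm_nonneg _).trans h1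
      gcongr)
    intervalIntegrable_const
    (Eventually.of_forall fun t _ u hu => by
      have h1 : HasDerivAt (fun u : ℂ => ψ (circleMap c R t) - u) (-1) u := by
        simpa using (hasDerivAt_id u).const_sub (ψ (circleMap c R t))
      have h2 := (((hasDerivAt_const u (φ (circleMap c R t))).div h1
        (hne _ (hmem t) u hu))).const_smul (deriv (circleMap c R) t)
      convert! h2 using 2
      simp)
  exact key.2.differentiableAt

lemma analyticAt_circleIntegral_div_sub {φ ψ : ℂ → ℂ} {c : ℂ} {R : ℝ} (hR : 0 ≤ R)
    (hφ : ContinuousOn φ (Metric.sphere c R)) (hψ : ContinuousOn ψ (Metric.sphere c R)) {u₀ : ℂ}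
    (h : ∀ x ∈ Metric.sphere c R, ψ x ≠ u₀) :
    AnalyticAt ℂ (fun u => ∮ x in C(c, R), φ x / (ψ x - u)) u₀ := by
  rw [Complex.analyticAt_iff_eventually_differentiableAt]
  filter_upwards [eventually_forall_sphere_ne hψ h] with u hu
  exact differentiableAt_circleIntegral_div_sub hR hφ hψ hu

/-! ### Topology of the fibres -/

lemma isOpen_regular (r : RatFunc ℂ) : IsOpen {z | IsRegularAt r z} :=
  isOpen_ne_fun r.denom.continuous continuous_const

lemma analyticAt_eval (f : ℂ[X]) (z : ℂ) : AnalyticAt ℂ (fun x => f.eval x) z :=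
  AnalyticOnNhd.eval_polynomial f z (Set.mem_univ z)

lemma analyticAt_val {r : RatFunc ℂ} {z : ℂ} (hz : IsRegularAt r z) :
    AnalyticAt ℂ (val r) z := by
  rw [funext (val_eq r)]
  exact (analyticAt_eval _ z).div (analyticAt_eval _ z) hz

lemma continuousAt_val {r : RatFunc ℂ} {z : ℂ} (hz : IsRegularAt r z) :
    ContinuousAt (val r) z := (analyticAt_val hz).continuousAt

/-- The points of the fibre over `u` in a fixed disk stay near the fibre over `u₀`. -/
lemma eventually_fiber_subset_of_norm_le {r : RatFunc ℂ} {U : Set ℂ} (hU : IsOpen U) {u₀ : ℂ}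
    (hfib : fiber r u₀ ⊆ U) (ρ : ℝ) :
    ∀ᶠ u in 𝓝 u₀, ∀ z ∈ fiber r u, ‖z‖ ≤ ρ → z ∈ U := by
  have hK : IsCompact (Metric.closedBall (0 : ℂ) ρ \ U) :=
    (isCompact_closedBall 0 ρ).diff hU
  -- Compactness makes the nonvanishing of the pencil near (u₀, z) uniform in z.
  have h1 := hK.eventually_forall_of_forall_eventually (x₀ := u₀)
    (P := fun u z => (pencil r u).eval z ≠ 0) (fun z hz => by
      have hc : Continuous fun a : ℂ × ℂ => (pencil r a.1).eval a.2 := by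
        simp only [eval_pencil]
        exact (r.num.continuous.comp continuous_snd).sub
          (continuous_fst.mul (r.denom.continuous.comp continuous_snd))
      refine hc.continuousAt.eventually_ne ?_
      intro h0
      exact hz.2 (hfib (mem_fiber_iff.mpr h0)))
  filter_upwards [h1] with u hu z hz hzρ
  by_contra hzU
  exact hu z ⟨by simpa using hzρ, hzU⟩ (mem_fiber_iff.mp hz)

/-- Away from `r(∞)` the nearby fibres stay bounded. -/
lemma exists_eventually_fiber_norm_le {r : RatFunc ℂ} (hnum : 1 ≤ r.num.natDegree)
    (hdeg : r.denom.natDegree ≤ r.num.natDegree) {u₀ : ℂ} (hu₀ : ¬ HasValueAtInfinity r u₀) :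
    ∃ ρ, ∀ᶠ u in 𝓝 u₀, ∀ z ∈ fiber r u, ‖z‖ ≤ ρ := by
  -- Full degree of the pencil gives |q| ≤ C |p - u₀ q| far out. On the fibre over u one has p - u₀
  -- q = (u - u₀) q, hence 1 ≤ C |u - u₀|, which fails near u₀.
  have hd : r.denom.degree ≤ (pencil r u₀).degree := by
    rw [degree_eq_natDegree r.denom_ne_zero, degree_eq_natDegree (pencil_ne_zero hnum u₀),
      natDegree_pencil hdeg hnum hu₀]
    exact_mod_cast hdeg
  obtain ⟨C, hC, hbd⟩ := (isBigO_cobounded_of_degree_le hd).exists_pos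
  obtain ⟨ρ, -, hρ⟩ := hasBasis_cobounded_norm.eventually_iff.mp hbd.bound
  refine ⟨ρ, ?_⟩
  filter_upwards [Metric.ball_mem_nhds u₀ (inv_pos.mpr hC)] with u hu z hz
  by_contra hlt
  have h1 : ‖r.denom.eval z‖ ≤ C * ‖(pencil r u₀).eval z‖ := hρ (not_le.mp hlt).le
  have hq : 0 < ‖r.denom.eval z‖ := norm_pos_iff.mpr hz.1
  rw [eval_pencil_of_regular hz.1, hz.2, norm_mul, ← mul_assoc] at h1
  rw [Metric.mem_ball, dist_eq_norm] at hu
  have h2 : C * ‖u - u₀‖ < 1 := by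
    calc C * ‖u - u₀‖ < C * C⁻¹ := by gcongr
      _ = 1 := mul_inv_cancel₀ hC.ne'
  nlinarith

lemma exists_radius {S : Set ℂ} (hS : S.Finite) {D : Set ℂ} (hD : IsOpen D) (hSD : S ⊆ D) :
    ∃ ε > 0, (∀ a ∈ S, Metric.closedBall a ε ⊆ D) ∧
      ∀ a ∈ S, ∀ b ∈ S, a ≠ b → 2 * ε < dist a b := by
  have h1 : ∀ᶠ ε in 𝓝 (0 : ℝ), ∀ a ∈ S, Metric.closedBall a ε ⊆ D :=
    (Set.Finite.eventually_all hS).mpr fun a ha =>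
      eventually_closedBall_subset (hD.mem_nhds (hSD ha))
  have h2 : ∀ᶠ ε in 𝓝 (0 : ℝ), ∀ a ∈ S, ∀ b ∈ S, a ≠ b → 2 * ε < dist a b := by
    refine (Set.Finite.eventually_all hS).mpr fun a _ =>
      (Set.Finite.eventually_all hS).mpr fun b _ => ?_
    by_cases hab : a = b
    · simp [hab]
    · have : Tendsto (fun ε : ℝ => 2 * ε) (𝓝 0) (𝓝 0) := by
        have h := (show Continuous fun ε : ℝ => 2 * ε by fun_prop).tendsto 0
        rwa [mul_zero] at h
      filter_upwards [this.eventually_lt_const (dist_pos.mpr hab)] with ε hε _ using hε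
  obtain ⟨ε, ⟨hε1, hε2⟩, hε⟩ := (((h1.and h2).filter_mono nhdsWithin_le_nhds).and
    (self_mem_nhdsWithin (s := Set.Ioi (0 : ℝ)))).exists
  exact ⟨ε, hε, hε1, hε2⟩

/-! ### Coordinates of analytic functions along the fibres -/

/-- On the fibre over u the Bezoutian turns 1/(θ - z) into ∑ₘ eₘ(z) cₘ(θ)/(q(θ)(r(θ) - u)), so the
integral has coordinates analytic in u. The parametrization θ(y) = y serves finite disks and θ(y) =
1/y a neighbourhood of infinity. -/
lemma integral_coordinates {r : RatFunc ℂ} (hnum : 1 ≤ r.num.natDegree)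
    (hdeg : r.denom.natDegree ≤ r.num.natDegree)
    (e : Module.Basis (Fin (deg r)) ℂ (stateSpace r)) {θ k : ℂ → ℂ} {a : ℂ} {R : ℝ} (hR : 0 ≤ R)
    (hθ : ContinuousOn θ (Metric.sphere a R)) (hk : ContinuousOn k (Metric.sphere a R)) {u₀ : ℂ}
    (hreg : ∀ y ∈ Metric.sphere a R, IsRegularAt r (θ y))
    (hne : ∀ y ∈ Metric.sphere a R, val r (θ y) ≠ u₀) :
    ∃ G : Fin (deg r) → ℂ → ℂ, (∀ m, AnalyticAt ℂ (G m) u₀) ∧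
      ∀ᶠ u in 𝓝 u₀, ∀ z ∈ fiber r u, (∀ y ∈ Metric.sphere a R, θ y ≠ z) ∧
        ∑ m, val (e m : RatFunc ℂ) z * G m u = ∮ y in C(a, R), k y / (θ y - z) := by
  obtain ⟨s, c, -, hv, -, hc⟩ := exists_basis_numerators hnum hdeg e
  have hval : ContinuousOn (fun y => val r (θ y)) (Metric.sphere a R) := fun y hy =>
    (continuousAt_val (hreg y hy)).comp_continuousWithinAt (hθ y hy)
  have hφ : ∀ m, ContinuousOn (fun y => k y * ((c m).eval (θ y) / r.denom.eval (θ y)))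
      (Metric.sphere a R) := fun m =>
    hk.mul (((c m).continuous.comp_continuousOn hθ).div
      (r.denom.continuous.comp_continuousOn hθ) hreg)
  refine ⟨fun m u => ∮ y in C(a, R), k y * ((c m).eval (θ y) / r.denom.eval (θ y)) /
    (val r (θ y) - u), fun m => analyticAt_circleIntegral_div_sub hR (hφ m) hval hne, ?_⟩
  filter_upwards [eventually_forall_sphere_ne hval hne] with u hu z hz
  have hθz : ∀ y ∈ Metric.sphere a R, θ y ≠ z := by
    intro y hy h
    exact hu y hy (h ▸ hz.2)
  refine ⟨hθz, ?_⟩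
  simp only [← circleIntegral.integral_const_mul]
  rw [← circleIntegral.integral_fun_sum]
  · refine circleIntegral.integral_congr hR fun y hy => ?_
    have h1 := hc (θ y) z
    have hq : r.denom.eval (θ y) ≠ 0 := hreg y hy
    have hqz : r.denom.eval z ≠ 0 := hz.1
    have h2 : val r (θ y) - u ≠ 0 := sub_ne_zero.mpr (hu y hy)
    have h3 : θ y - z ≠ 0 := sub_ne_zero.mpr (hθz y hy)
    have h4 : ∑ m, val (e m : RatFunc ℂ) z * (c m).eval (θ y) =
        (val r (θ y) - u) * r.denom.eval (θ y) / (θ y - z) := by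
      have h5 : ∑ m, val (e m : RatFunc ℂ) z * (c m).eval (θ y) =
          (∑ m, (s m).eval z * (c m).eval (θ y)) / r.denom.eval z := by
        rw [Finset.sum_div]
        refine Finset.sum_congr rfl fun m _ => ?_
        rw [hv m z hz.1]
        ring
      have h6 : r.num.eval z = u * r.denom.eval z := by
        rw [← hz.2, val_eq]; field_simp
      rw [h5, eq_div_iff h3, div_mul_eq_mul_div, mul_comm _ (θ y - z), ← h1, h6, val_eq]
      field_simp
    calc ∑ m, val (e m : RatFunc ℂ) z *
          (k y * ((c m).eval (θ y) / r.denom.eval (θ y)) / (val r (θ y) - u))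
        = (∑ m, val (e m : RatFunc ℂ) z * (c m).eval (θ y)) *
            (k y / (r.denom.eval (θ y) * (val r (θ y) - u))) := by
          rw [Finset.sum_mul]
          refine Finset.sum_congr rfl fun m _ => ?_
          field_simp
      _ = k y / (θ y - z) := by
          rw [h4]
          field_simp
  · intro m _
    exact (continuousOn_const.mul ((hφ m).div (hval.sub continuousOn_const)
      fun y hy => sub_ne_zero.mpr (hu y hy))).circleIntegrable hR

/-- Cauchy's formula for fibre points inside the disk, Cauchy's theorem for those outside. Thus the
contributions of disjoint disks add without interfering. -/
lemma disk_coordinates {r : RatFunc ℂ} (hnum : 1 ≤ r.num.natDegree)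
    (hdeg : r.denom.natDegree ≤ r.num.natDegree)
    (e : Module.Basis (Fin (deg r)) ℂ (stateSpace r)) {h : ℂ → ℂ} {a : ℂ} {R : ℝ} (hR : 0 < R)
    (hh : DifferentiableOn ℂ h (Metric.closedBall a R)) {u₀ : ℂ}
    (hreg : ∀ y ∈ Metric.sphere a R, IsRegularAt r y)
    (hne : ∀ y ∈ Metric.sphere a R, val r y ≠ u₀) :
    ∃ G : Fin (deg r) → ℂ → ℂ, (∀ m, AnalyticAt ℂ (G m) u₀) ∧
      ∀ᶠ u in 𝓝 u₀, ∀ z ∈ fiber r u,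
        (z ∈ Metric.ball a R → ∑ m, val (e m : RatFunc ℂ) z * G m u = h z) ∧
        (z ∉ Metric.ball a R → ∑ m, val (e m : RatFunc ℂ) z * G m u = 0) := by
  have hk : ContinuousOn (fun y => (2 * Real.pi * Complex.I : ℂ)⁻¹ * h y)
      (Metric.sphere a R) :=
    continuousOn_const.mul (hh.continuousOn.mono Metric.sphere_subset_closedBall)
  obtain ⟨G, hG, hev⟩ := integral_coordinates hnum hdeg e hR.le continuousOn_id hk hreg hne
  refine ⟨G, hG, ?_⟩
  filter_upwards [hev] with u hu z hz
  obtain ⟨h1, h2⟩ := hu z hz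
  simp only [id_eq] at h1 h2
  rw [h2]
  have h3 : ∮ y in C(a, R), (2 * Real.pi * Complex.I : ℂ)⁻¹ * h y / (y - z) =
      (2 * Real.pi * Complex.I : ℂ)⁻¹ * ∮ y in C(a, R), (y - z)⁻¹ • h y := by
    rw [← circleIntegral.integral_const_mul]
    congr 1
    ext y
    rw [smul_eq_mul]
    ring
  rw [h3]
  constructor
  · intro hzb
    rw [hh.circleIntegral_sub_inv_smul hzb, smul_eq_mul,
      inv_mul_cancel_left₀ Complex.two_pi_I_ne_zero]
  · intro hzb
    have hzc : ∀ y ∈ Metric.closedBall a R, y - z ≠ 0 := by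
      intro y hy h0
      have hyz : y = z := sub_eq_zero.mp h0
      have hzs : z ∈ Metric.sphere a R := by
        rw [hyz, Metric.mem_closedBall] at hy
        rw [Metric.mem_ball, not_lt] at hzb
        exact le_antisymm hy hzb
      exact h1 z hzs rfl
    have hd : DifferentiableOn ℂ (fun y => (y - z)⁻¹ • h y) (Metric.closedBall a R) :=
      ((differentiableOn_id.sub_const z).inv hzc).smul hh
    rw [(hd.diffContOnCl_ball subset_rfl).circleIntegral_eq_zero hR.le, mul_zero]

/-- An analytic function near infinity that vanishes there is `y k(y)` in the variable `y = 1/z`. -/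
lemma exists_differentiableOn_inv {h : ℂ → ℂ} {ρ : ℝ} (hρ : 0 < ρ)
    (hh : ∀ z, ρ ≤ ‖z‖ → DifferentiableAt ℂ h z)
    (hinf : Tendsto h (Bornology.cobounded ℂ) (𝓝 0)) :
    ∃ k : ℂ → ℂ, DifferentiableOn ℂ k (Metric.closedBall 0 ρ⁻¹) ∧
      ∀ y, y ≠ 0 → h y⁻¹ = y * k y := by
  -- The value 0 is the limit at the origin, so the singularity is removable; k is then the slope of
  -- f from 0.
  set f : ℂ → ℂ := fun y => if y = 0 then 0 else h y⁻¹ with hf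
  have hball : ∀ y ∈ Metric.closedBall (0 : ℂ) ρ⁻¹, y ≠ 0 → DifferentiableAt ℂ f y := by
    intro y hy hy0
    have h1 : DifferentiableAt ℂ (fun y => h y⁻¹) y := by
      refine DifferentiableAt.comp y (hh y⁻¹ ?_) (differentiableAt_inv hy0)
      rw [norm_inv]
      rw [mem_closedBall_zero_iff] at hy
      exact (le_inv_comm₀ hρ (norm_pos_iff.mpr hy0)).mpr hy
    refine h1.congr_of_eventuallyEq ?_
    filter_upwards [isOpen_ne.mem_nhds hy0] with x hx
    simp only [hf]
    rw [if_neg hx]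
  have hcont : ContinuousAt f 0 := by
    rw [continuousAt_iff_punctured_nhds]
    have h1 : Tendsto (fun y => h y⁻¹) (𝓝[≠] 0) (𝓝 0) := hinf.comp tendsto_inv₀_nhdsNE_zero
    have h2 : f 0 = 0 := by simp [hf]
    rw [h2]
    refine h1.congr' ?_
    filter_upwards [self_mem_nhdsWithin] with y hy
    exact (if_neg (show y ≠ 0 from hy)).symm
  have hnhds : Metric.closedBall (0 : ℂ) ρ⁻¹ ∈ 𝓝 0 := Metric.closedBall_mem_nhds _ (inv_pos.mpr hρ)
  have h0 : AnalyticAt ℂ f 0 := by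
    refine Complex.analyticAt_of_differentiable_on_punctured_nhds_of_continuousAt ?_ hcont
    filter_upwards [nhdsWithin_le_nhds hnhds, self_mem_nhdsWithin] with y hy hy0
    exact hball y hy hy0
  have hd : DifferentiableOn ℂ f (Metric.closedBall 0 ρ⁻¹) := by
    intro y hy
    by_cases hy0 : y = 0
    · rw [hy0]; exact h0.differentiableAt.differentiableWithinAt
    · exact (hball y hy hy0).differentiableWithinAt
  refine ⟨dslope f 0, (Complex.differentiableOn_dslope hnhds).mpr hd, fun y hy => ?_⟩
  have h1 := sub_smul_dslope f 0 y
  simp only [sub_zero, smul_eq_mul] at h1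
  rw [h1]
  simp [hf, hy]

/-- In y = 1/z the exterior becomes a disk, and h(z) = z⁻¹ k(1/z) is recovered from Cauchy's formula
for k at 1/z. -/
lemma exterior_coordinates {r : RatFunc ℂ} (hnum : 1 ≤ r.num.natDegree)
    (hdeg : r.denom.natDegree ≤ r.num.natDegree)
    (e : Module.Basis (Fin (deg r)) ℂ (stateSpace r)) {h : ℂ → ℂ} {ρ : ℝ} (hρ : 0 < ρ)
    (hh : ∀ z, ρ ≤ ‖z‖ → DifferentiableAt ℂ h z)
    (hinf : Tendsto h (Bornology.cobounded ℂ) (𝓝 0)) {u₀ : ℂ}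
    (hreg : ∀ y, ‖y‖ = ρ → IsRegularAt r y) (hne : ∀ y, ‖y‖ = ρ → val r y ≠ u₀) :
    ∃ G : Fin (deg r) → ℂ → ℂ, (∀ m, AnalyticAt ℂ (G m) u₀) ∧
      ∀ᶠ u in 𝓝 u₀, ∀ z ∈ fiber r u,
        (ρ < ‖z‖ → ∑ m, val (e m : RatFunc ℂ) z * G m u = h z) ∧
        (‖z‖ < ρ → ∑ m, val (e m : RatFunc ℂ) z * G m u = 0) := by
  obtain ⟨k, hk, hhk⟩ := exists_differentiableOn_inv hρ hh hinf
  have hρ' : 0 < ρ⁻¹ := inv_pos.mpr hρ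
  have hsph : ∀ y ∈ Metric.sphere (0 : ℂ) ρ⁻¹, y ≠ 0 ∧ ‖y⁻¹‖ = ρ := by
    intro y hy
    rw [mem_sphere_zero_iff_norm] at hy
    refine ⟨?_, by rw [norm_inv, hy, inv_inv]⟩
    rintro rfl
    rw [norm_zero] at hy
    exact hρ'.ne hy
  have hθ : ContinuousOn (fun y : ℂ => y⁻¹) (Metric.sphere 0 ρ⁻¹) :=
    continuousOn_id.inv₀ fun y hy => (hsph y hy).1
  -- The factor y⁻¹ is chosen so that y⁻¹/(y⁻¹ - z) = 1/(1 - yz) = -z⁻¹/(y - z⁻¹), a Cauchy kernel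
  -- at 1/z; the minus sign cancels the one produced here. For |z| < ρ the function 1/(1 - yz) is
  -- analytic on the disk and the integral vanishes.
  have hk' : ContinuousOn (fun y => -(2 * Real.pi * Complex.I : ℂ)⁻¹ * k y * y⁻¹)
      (Metric.sphere 0 ρ⁻¹) :=
    (continuousOn_const.mul (hk.continuousOn.mono Metric.sphere_subset_closedBall)).mul hθ
  obtain ⟨G, hG, hev⟩ := integral_coordinates hnum hdeg e hρ'.le hθ hk' (u₀ := u₀)
    (fun y hy => hreg _ (hsph y hy).2) (fun y hy => hne _ (hsph y hy).2)
  refine ⟨G, hG, ?_⟩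
  filter_upwards [hev] with u hu z hz
  obtain ⟨h1, h2⟩ := hu z hz
  rw [h2]
  constructor
  · intro hzρ
    have hz0 : z ≠ 0 := norm_pos_iff.mp (hρ.trans hzρ)
    have h3 : ∮ y in C(0, ρ⁻¹), -(2 * Real.pi * Complex.I : ℂ)⁻¹ * k y * y⁻¹ / (y⁻¹ - z) =
        (2 * Real.pi * Complex.I : ℂ)⁻¹ * z⁻¹ * ∮ y in C(0, ρ⁻¹), (y - z⁻¹)⁻¹ • k y := by
      rw [← circleIntegral.integral_const_mul]
      refine circleIntegral.integral_congr hρ'.le fun y hy => ?_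
      have hy0 := (hsph y hy).1
      have h4 : y⁻¹ - z ≠ 0 := sub_ne_zero.mpr (h1 y hy)
      have h5 : y - z⁻¹ ≠ 0 := by
        intro h
        apply h4
        rw [sub_eq_zero.mp h, inv_inv, sub_self]
      have h6 : y⁻¹ / (y⁻¹ - z) = -(z⁻¹ * (y - z⁻¹)⁻¹) := by
        rw [div_eq_iff h4]
        field_simp
        have : y * z - 1 ≠ 0 := by
          intro h
          apply h5
          field_simp
          rw [h, mul_zero]
        field_simp
        ring
      simp only [smul_eq_mul]
      rw [mul_div_assoc, h6]
      ring
    rw [h3, hk.circleIntegral_sub_inv_smul, smul_eq_mul, mul_comm _ z⁻¹, mul_assoc,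
      inv_mul_cancel_left₀ Complex.two_pi_I_ne_zero, ← hhk _ (inv_ne_zero hz0), inv_inv]
    rw [mem_ball_zero_iff, norm_inv]
    exact (inv_lt_inv₀ (hρ.trans hzρ) hρ).mpr hzρ
  · intro hzρ
    have hyz : ∀ y ∈ Metric.closedBall (0 : ℂ) ρ⁻¹, 1 - y * z ≠ 0 := by
      intro y hy h
      rw [mem_closedBall_zero_iff] at hy
      have h3 : ‖y * z‖ = 1 := by rw [← sub_eq_zero.mp h, norm_one]
      have h4 : ‖y * z‖ < 1 := by
        rw [norm_mul]
        calc ‖y‖ * ‖z‖ ≤ ρ⁻¹ * ‖z‖ := by gcongr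
          _ < ρ⁻¹ * ρ := by gcongr
          _ = 1 := inv_mul_cancel₀ hρ.ne'
      exact h4.ne h3
    have hd : DifferentiableOn ℂ
        (fun y => -(2 * Real.pi * Complex.I : ℂ)⁻¹ * k y / (1 - y * z))
        (Metric.closedBall 0 ρ⁻¹) :=
      (hk.const_mul _).div (by fun_prop) hyz
    refine Eq.trans ?_ ((hd.diffContOnCl_ball subset_rfl).circleIntegral_eq_zero hρ'.le)
    refine circleIntegral.integral_congr hρ'.le fun y hy => ?_
    have hy0 := (hsph y hy).1
    have h4 : y⁻¹ - z ≠ 0 := sub_ne_zero.mpr (h1 y hy)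
    have h5 := hyz y (Metric.sphere_subset_closedBall hy)
    rw [div_eq_div_iff h4 h5, mul_assoc, mul_sub, mul_sub, mul_one]
    field_simp
    ring

/-- Disk coordinates are summed over the fibre of u₀. A point lies in at most one disk because the
centres are more than 2ε apart. The vanishing off `U` allows a later addition of the contribution
from infinity. -/
lemma exists_local_coordinates_finite {r : RatFunc ℂ} (hnum : 1 ≤ r.num.natDegree)
    (hdeg : r.denom.natDegree ≤ r.num.natDegree)
    (e : Module.Basis (Fin (deg r)) ℂ (stateSpace r)) {D : Set ℂ} (hD : IsOpen D) {h : ℂ → ℂ}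
    (hh : DifferentiableOn ℂ h D) {u₀ : ℂ} (hfib : fiber r u₀ ⊆ D) :
    ∃ U : Set ℂ, IsOpen U ∧ fiber r u₀ ⊆ U ∧ U ⊆ D ∧
    ∃ G : Fin (deg r) → ℂ → ℂ, (∀ m, AnalyticAt ℂ (G m) u₀) ∧
      ∀ᶠ u in 𝓝 u₀, ∀ z ∈ fiber r u,
        (z ∈ U → ∑ m, val (e m : RatFunc ℂ) z * G m u = h z) ∧
        (z ∉ U → ∑ m, val (e m : RatFunc ℂ) z * G m u = 0) := by
  classical
  have hfin := finite_fiber hnum u₀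
  obtain ⟨ε, hε, hεD, hεd⟩ := exists_radius hfin (hD.inter (isOpen_regular r))
    (fun z hz => ⟨hfib hz, hz.1⟩)
  have hsph : ∀ a ∈ fiber r u₀, ∀ y ∈ Metric.sphere a ε, val r y ≠ u₀ := by
    intro a ha y hy hyu
    have hyf : y ∈ fiber r u₀ :=
      ⟨(hεD a ha (Metric.sphere_subset_closedBall hy)).2, hyu⟩
    rw [Metric.mem_sphere] at hy
    by_cases hya : y = a
    · rw [hya, dist_self] at hy
      exact hε.ne hy
    · have := hεd y hyf a ha hya
      linarith
  have hG : ∀ a : fiber r u₀, ∃ G : Fin (deg r) → ℂ → ℂ, (∀ m, AnalyticAt ℂ (G m) u₀) ∧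
      ∀ᶠ u in 𝓝 u₀, ∀ z ∈ fiber r u,
        (z ∈ Metric.ball (a : ℂ) ε → ∑ m, val (e m : RatFunc ℂ) z * G m u = h z) ∧
        (z ∉ Metric.ball (a : ℂ) ε → ∑ m, val (e m : RatFunc ℂ) z * G m u = 0) := fun a =>
    disk_coordinates hnum hdeg e hε (hh.mono fun y hy => (hεD a a.2 hy).1)
      (fun y hy => (hεD a a.2 (Metric.sphere_subset_closedBall hy)).2) (hsph a a.2)
  choose G hGa hGe using hG
  have : Fintype (fiber r u₀) := hfin.fintype
  refine ⟨⋃ a ∈ fiber r u₀, Metric.ball a ε, isOpen_biUnion fun _ _ => Metric.isOpen_ball,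
    fun z hz => Set.mem_biUnion hz (Metric.mem_ball_self hε),
    Set.iUnion₂_subset fun a ha y hy => (hεD a ha (Metric.ball_subset_closedBall hy)).1,
    fun m u => ∑ a : fiber r u₀, G a m u,
    fun m => Finset.analyticAt_fun_sum _ fun a _ => hGa a m, ?_⟩
  filter_upwards [eventually_all.mpr hGe] with u hu z hz
  have hsum : ∑ m, val (e m : RatFunc ℂ) z * ∑ a : fiber r u₀, G a m u =
      ∑ a : fiber r u₀, ∑ m, val (e m : RatFunc ℂ) z * G a m u := by
    simp only [Finset.mul_sum]
    exact Finset.sum_comm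
  rw [hsum]
  constructor
  · intro hzU
    obtain ⟨a, ha, hza⟩ := Set.mem_iUnion₂.mp hzU
    rw [Finset.sum_eq_single (⟨a, ha⟩ : fiber r u₀) _ (by simp)]
    · exact (hu ⟨a, ha⟩ z hz).1 hza
    · intro b _ hb
      refine (hu b z hz).2 fun hzb => ?_
      have h1 := hεd b b.2 a ha fun h => hb (Subtype.ext h)
      rw [Metric.mem_ball] at hza hzb
      have h2 := dist_triangle_left (b : ℂ) a z
      linarith
  · intro hzU
    exact Finset.sum_eq_zero fun a _ => (hu a z hz).2 fun hza =>
      hzU (Set.mem_biUnion a.2 hza)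

/-- Near `u₀` the coordinates of `h` along the fibres of `r` are analytic. -/
lemma exists_local_coordinates {r : RatFunc ℂ} (hnum : 1 ≤ r.num.natDegree)
    (hdeg : r.denom.natDegree ≤ r.num.natDegree)
    (e : Module.Basis (Fin (deg r)) ℂ (stateSpace r)) {D : Set ℂ} (hD : IsOpen D) {h : ℂ → ℂ}
    (hh : DifferentiableOn ℂ h D) {u₀ : ℂ} (hfib : fiber r u₀ ⊆ D)
    (hinf : HasValueAtInfinity r u₀ →
      Tendsto h (Bornology.cobounded ℂ) (𝓝 0) ∧ ∀ᶠ z in Bornology.cobounded ℂ, z ∈ D) :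
    ∃ G : Fin (deg r) → ℂ → ℂ, (∀ m, AnalyticAt ℂ (G m) u₀) ∧
      ∀ᶠ u in 𝓝 u₀, ∀ z ∈ fiber r u, h z = ∑ m, val (e m : RatFunc ℂ) z * G m u := by
  by_cases hu₀ : HasValueAtInfinity r u₀
  · obtain ⟨hlim, hcob⟩ := hinf hu₀
    have hfinite : ∀ f : ℂ[X], f ≠ 0 → ∀ᶠ z in Bornology.cobounded ℂ, f.eval z ≠ 0 := by
      intro f hf
      have h1 : {z | f.eval z = 0}.Finite :=
        f.roots.toFinset.finite_toSet.subset fun z hz => by simpa [hf] using hz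
      exact Bornology.le_cofinite _ h1.compl_mem_cofinite
    have hall := ((hcob.and (hfinite _ r.denom_ne_zero)).and
      (hfinite _ (pencil_ne_zero hnum u₀)))
    obtain ⟨ρ₀, -, hρ₀⟩ := hasBasis_cobounded_norm.eventually_iff.mp hall
    -- Outside radius ρ there are neither poles nor points of the fibre of u₀, so nearby fibres
    -- split into points in `U` and points of norm greater than ρ.
    set ρ := max ρ₀ 1
    have hρ : 0 < ρ := lt_max_of_lt_right one_pos
    have hρD : ∀ z, ρ ≤ ‖z‖ → (z ∈ D ∧ IsRegularAt r z) ∧ (pencil r u₀).eval z ≠ 0 :=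
      fun z hz => hρ₀ ((le_max_left _ _).trans hz)
    have hval : ∀ z, ρ ≤ ‖z‖ → val r z ≠ u₀ := fun z hz hzu =>
      (hρD z hz).2 (mem_fiber_iff.mp ⟨(hρD z hz).1.2, hzu⟩)
    obtain ⟨U, hU, hfU, hUD, G, hG, hGe⟩ := exists_local_coordinates_finite hnum hdeg e
      (hD.inter (Metric.isOpen_ball (x := (0 : ℂ)) (ε := ρ))) (hh.mono Set.inter_subset_left)
      (u₀ := u₀) (fun z hz => ⟨hfib hz, by
        rw [mem_ball_zero_iff]
        by_contra hlt
        exact hval z (not_lt.mp hlt) hz.2⟩)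
    obtain ⟨G', hG', hGe'⟩ := exterior_coordinates hnum hdeg e hρ
      (fun z hz => hh.differentiableAt (hD.mem_nhds (hρD z hz).1.1)) hlim (u₀ := u₀)
      (fun z hz => (hρD z hz.ge).1.2) (fun z hz => hval z hz.ge)
    refine ⟨fun m u => G m u + G' m u, fun m => (hG m).fun_add (hG' m), ?_⟩
    filter_upwards [hGe, hGe', eventually_fiber_subset_of_norm_le hU hfU ρ] with u h1 h2 h3 z hz
    simp only [mul_add, Finset.sum_add_distrib]
    by_cases hzρ : ‖z‖ ≤ ρ
    · have hzU := h3 z hz hzρ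
      rw [(h1 z hz).1 hzU, (h2 z hz).2 (mem_ball_zero_iff.mp (hUD hzU).2), add_zero]
    · have hzU : z ∉ U := fun hzU => hzρ (mem_ball_zero_iff.mp (hUD hzU).2).le
      rw [(h1 z hz).2 hzU, (h2 z hz).1 (not_le.mp hzρ), zero_add]
  · obtain ⟨U, hU, hfU, hUD, G, hG, hGe⟩ := exists_local_coordinates_finite hnum hdeg e hD hh hfib
    obtain ⟨ρ, hρ⟩ := exists_eventually_fiber_norm_le hnum hdeg hu₀
    refine ⟨G, hG, ?_⟩
    filter_upwards [hGe, hρ, eventually_fiber_subset_of_norm_le hU hfU ρ] with u h1 h2 h3 z hz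
    exact ((h1 z hz).1 (h3 z hz (h2 z hz))).symm

lemma eventually_nhdsNE_mem_Omega {r : RatFunc ℂ} (hnum : 1 ≤ r.num.natDegree)
    (hdeg : r.denom.natDegree ≤ r.num.natDegree) (u : ℂ) : ∀ᶠ v in 𝓝[≠] u, v ∈ Omega r := by
  have h1 := (finite_compl_Omega hnum hdeg).compl_mem_cofinite
  rw [compl_compl] at h1
  exact nhdsNE_le_cofinite _ h1

/-- An analytic function on `r⁻¹(B)` is a combination of the basis elements of the state space,
with coefficients that are analytic functions of `r` on `B`. -/
theorem exists_coordinates {r : RatFunc ℂ} (hnum : 1 ≤ r.num.natDegree)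
    (hdeg : r.denom.natDegree ≤ r.num.natDegree)
    (e : Module.Basis (Fin (deg r)) ℂ (stateSpace r)) {D B : Set ℂ} (hD : IsOpen D)
    (hB : IsOpen B)
    {h : ℂ → ℂ} (hh : DifferentiableOn ℂ h D) (hBD : ∀ u ∈ B, fiber r u ⊆ D)
    (hinf : ∀ u ∈ B, HasValueAtInfinity r u →
      Tendsto h (Bornology.cobounded ℂ) (𝓝 0) ∧ ∀ᶠ z in Bornology.cobounded ℂ, z ∈ D) :
    ∃ G : Fin (deg r) → ℂ → ℂ, (∀ m, AnalyticOnNhd ℂ (G m) B) ∧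
      ∀ u ∈ B, ∀ z ∈ fiber r u, h z = ∑ m, val (e m : RatFunc ℂ) z * G m u := by
  classical
  choose! G hG hGe using fun u (hu : u ∈ B) =>
    exists_local_coordinates hnum hdeg e hD hh (hBD u hu) (hinf u hu)
  -- Gluing: each u uses its own local coordinates. Two local choices agree at all nearby v in Ω(r),
  -- where coordinates are unique, hence also at u by continuity.
  refine ⟨fun m u => G u m u, fun m u₀ hu₀ => (hG u₀ hu₀ m).congr ?_,
    fun u hu z hz => (hGe u hu).self_of_nhds z hz⟩
  filter_upwards [hB.mem_nhds hu₀, (hGe u₀ hu₀).eventually_nhds,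
    eventually_all.mpr fun m => (hG u₀ hu₀ m).eventually_analyticAt] with u hu hue hua
  refine (((hua m).continuousAt.eventuallyEq_nhds_iff_eventuallyEq_nhdsNE
    (hG u hu m).continuousAt).mp ?_).self_of_nhds
  filter_upwards [nhdsWithin_le_nhds hue, nhdsWithin_le_nhds (hGe u hu),
    eventually_nhdsNE_mem_Omega hnum hdeg u] with v h1 h2 hv
  have h3 := eq_zero_of_sum_val_eq_zero hnum hdeg e hv (g := fun m => G u₀ m v - G u m v)
    fun z hz => by
      simp only [mul_sub, Finset.sum_sub_distrib]
      rw [← h1 z hz, ← h2 z hz, sub_self]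
  exact sub_eq_zero.mp (congrFun h3 m)

/-! ### The sets `A(r)` and `r⁻¹(A(r))` -/

section Disks

variable {r : RatFunc ℂ} {L : ℕ} {w c : Fin L → ℂ} {R : Fin L → ℝ}

lemma isCompact_compl_A (hd : AdmissibleDisks r w c R) : IsCompact (A r c R)ᶜ := by
  rw [A, compl_compl]
  refine isCompact_iUnion fun l => (isCompact_sphere (c l) (R l)).image_of_continuousOn ?_
  exact fun z hz =>
    (continuousAt_val (hd.regular l z (Metric.sphere_subset_closedBall hz))).continuousWithinAt

lemma isOpen_A (hd : AdmissibleDisks r w c R) : IsOpen (A r c R) :=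
  isClosed_compl_iff.mp (isCompact_compl_A hd).isClosed

lemma exists_real_mem_Omega_inter_A (hnum : 1 ≤ r.num.natDegree)
    (hdeg : r.denom.natDegree ≤ r.num.natDegree) (hd : AdmissibleDisks r w c R) :
    ∃ α ∈ Omega r ∩ A r c R, conj α = α := by
  have hb : Bornology.IsBounded ((Omega r)ᶜ ∪ (A r c R)ᶜ) :=
    (finite_compl_Omega hnum hdeg).isBounded.union (isCompact_compl_A hd).isBounded
  obtain ⟨M, hM⟩ := hb.exists_norm_le
  refine ⟨((|M| + 1 : ℝ) : ℂ), ?_, Complex.conj_ofReal _⟩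
  by_contra hn
  rw [← Set.mem_compl_iff, Set.compl_inter] at hn
  have h1 := hM _ hn
  rw [Complex.norm_real, Real.norm_eq_abs, abs_of_nonneg (by positivity)] at h1
  linarith [le_abs_self M]

end Disks

lemma isOpen_preimage {r : RatFunc ℂ} {B : Set ℂ} (hB : IsOpen B) : IsOpen (preimage r B) := by
  rw [isOpen_iff_mem_nhds]
  rintro z ⟨hz, hzB⟩
  filter_upwards [(isOpen_regular r).mem_nhds hz,
    (continuousAt_val hz).preimage_mem_nhds (hB.mem_nhds hzB)] with x h1 h2 using ⟨h1, h2⟩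

lemma setOf_hasValueAtInfinity_finite (r : RatFunc ℂ) : {u | HasValueAtInfinity r u}.Finite :=
  (Set.finite_singleton (r.num.leadingCoeff / r.denom.leadingCoeff)).subset fun _ hu => hu.2

/-- Here r - u = (p - u q)/q, and the leading terms of p and u q cancel. -/
lemma tendsto_val_cobounded {r : RatFunc ℂ} (hnum : 1 ≤ r.num.natDegree) {u : ℂ}
    (hu : HasValueAtInfinity r u) : Tendsto (val r) (Bornology.cobounded ℂ) (𝓝 u) := by
  have hlt : (pencil r u).degree < r.denom.degree := by
    rw [degree_eq_natDegree r.denom_ne_zero, degree_eq_natDegree (pencil_ne_zero hnum u), ← hu.1]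
    exact_mod_cast natDegree_pencil_lt hnum hu
  have h1 := (isLittleO_cobounded_of_degree_lt hlt).tendsto_div_nhds_zero
  have h2 : {z | r.denom.eval z = 0}.Finite :=
    r.denom.roots.toFinset.finite_toSet.subset fun z hz => by
      simpa [r.denom_ne_zero] using hz
  rw [← tendsto_sub_nhds_zero_iff]
  refine h1.congr' ?_
  filter_upwards [Bornology.le_cofinite _ h2.compl_mem_cofinite] with z hz
  have hz' : r.denom.eval z ≠ 0 := hz
  rw [eval_pencil_of_regular hz', mul_div_cancel_right₀ _ hz']

/-! ### Reproducing kernels -/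

lemma zeroExt_apply {D : Set ℂ} {p : ℕ} (f : D → Fin p → ℂ) (z : D) :
    zeroExt f (z : ℂ) = f z := Subtype.val_injective.extend_apply f 0 z

lemma resolvent_apply {r : RatFunc ℂ} {α : ℂ} {D : Set ℂ} {p : ℕ} (f : D → Fin p → ℂ)
    [Fintype (fiber r α)] (hD : fiber r α ⊆ D) {z : D} (hz : val r z ≠ α) (i : Fin p) :
    resolvent r α f z i = (val r z - α)⁻¹ * f z i -
      ∑ w : fiber r α, (deriv (val r) w * (z - w))⁻¹ * f ⟨w, hD w.2⟩ i := by
  have h1 : ∀ w : fiber r α, zeroExt f (w : ℂ) = f ⟨w, hD w.2⟩ :=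
    fun w => zeroExt_apply f ⟨w, hD w.2⟩
  rw [resolvent, if_neg hz, resolventFormula, zeroExt_apply,
    ← finsum_set_coe_eq_finsum_mem (fiber r α), finsum_eq_sum_of_fintype]
  simp [h1]

section Kernel

variable {D : Set ℂ} {p : ℕ} {P : Submodule ℂ (D → Fin p → ℂ)} {form : P →ₗ[ℂ] P →ₗ⋆[ℂ] ℂ}
  {K : D → D → Matrix (Fin p) (Fin p) ℂ}

/-- The function `K(·, w) d` for a standard basis vector `d`. -/
def kernelColumn (K : D → D → Matrix (Fin p) (Fin p) ℂ) (w : D) (j : Fin p) : D → Fin p → ℂ :=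
  fun z => K z w *ᵥ Pi.single j 1

lemma kernelColumn_apply (w : D) (j : Fin p) (z : D) (i : Fin p) :
    kernelColumn K w j z i = K z w i j := by
  simp [kernelColumn]

lemma zeroExt_kernelColumn (w : D) (j : Fin p) (z : D) (i : Fin p) :
    zeroExt (kernelColumn K w j) (z : ℂ) i = K z w i j := by
  rw [zeroExt_apply, kernelColumn_apply]

lemma kernelColumn_mem (hK : IsReproducingKernel P form K) (w : D) (j : Fin p) :
    kernelColumn K w j ∈ P := (hK w (Pi.single j 1)).choose

lemma form_kernelColumn (hK : IsReproducingKernel P form K) (w : D) (j : Fin p) (f : P) :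
    form f ⟨kernelColumn K w j, kernelColumn_mem hK w j⟩ = (f : D → Fin p → ℂ) w j := by
  obtain ⟨_, h⟩ := hK w (Pi.single j 1)
  refine (h f).trans ?_
  rw [← Pi.single_star, star_one, single_one_dotProduct]

lemma kernel_conj (hherm : ∀ f g, form g f = conj (form f g)) (hK : IsReproducingKernel P form K)
    (z w : D) (i j : Fin p) : conj (K z w i j) = K w z j i := by
  have h1 := form_kernelColumn hK z i ⟨kernelColumn K w j, kernelColumn_mem hK w j⟩
  have h2 := form_kernelColumn hK w j ⟨kernelColumn K z i, kernelColumn_mem hK z i⟩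
  simp only [kernelColumn_apply] at h1 h2
  rw [← h1, ← h2, ← hherm]

end Kernel

/-- The symmetry of the resolvent at `α`, applied to the columns of the kernel. -/
lemma kernel_resolvent_identity {r : RatFunc ℂ} {D : Set ℂ} {p : ℕ}
    {P : Submodule ℂ (D → Fin p → ℂ)} {form : P →ₗ[ℂ] P →ₗ⋆[ℂ] ℂ}
    {K : D → D → Matrix (Fin p) (Fin p) ℂ} (hherm : ∀ f g, form g f = conj (form f g))
    (hK : IsReproducingKernel P form K) {α : ℂ}
    [Fintype (fiber r α)] (hD : fiber r α ⊆ D) (hinv : ∀ f ∈ P, resolvent r α f ∈ P)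
    (hid : ∀ f g : P, form f ⟨resolvent r α g.1, hinv g.1 g.2⟩
        = form ⟨resolvent r α f.1, hinv f.1 f.2⟩ g)
    {ζ z : D} (hζ : val r ζ ≠ α) (hz : val r z ≠ α) (i j : Fin p) :
    (val r ζ - α)⁻¹ * K ζ z i j
        - ∑ w : fiber r α, (deriv (val r) w * (ζ - w))⁻¹ * K ⟨w, hD w.2⟩ z i j
      = conj (val r z - α)⁻¹ * K ζ z i j
        - ∑ w : fiber r α, conj (deriv (val r) w * (z - w))⁻¹ * K ζ ⟨w, hD w.2⟩ i j := by
  have h1 := hid ⟨kernelColumn K ζ i, kernelColumn_mem hK ζ i⟩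
    ⟨kernelColumn K z j, kernelColumn_mem hK z j⟩
  -- One side reproduces the value at `z`; the other reproduces the value at `ζ` after a Hermitian
  -- flip.
  rw [form_kernelColumn hK, ← Complex.conj_conj (form _ _), ← hherm, form_kernelColumn hK] at h1
  simp only [resolvent_apply _ hD hζ, resolvent_apply _ hD hz, kernelColumn_apply] at h1
  have h2 := congrArg conj h1
  rw [Complex.conj_conj] at h2
  rw [h2]
  simp only [map_sub, map_mul, map_sum, kernel_conj hherm hK]

/-! ### The identity (r(ζ) - conj r(z)) K = Z (N - N^*) Z^* and its division. -/

lemma Z_mul_mul_apply {r : RatFunc ℂ} (e : Module.Basis (Fin (deg r)) ℂ (stateSpace r)) {p : ℕ}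
    (M : Matrix (Fin (deg r) × Fin p) (Fin (deg r) × Fin p) ℂ) (z w : ℂ) (i j : Fin p) :
    (Z e p z * M * (Z e p w)ᴴ) i j =
      ∑ k, ∑ m, val (e m : RatFunc ℂ) z * M (m, i) (k, j) * conj (val (e k : RatFunc ℂ) w) := by
  simp only [Matrix.mul_apply, Z, Matrix.of_apply, Matrix.conjTranspose_apply,
    Fintype.sum_prod_type, ite_mul, zero_mul, apply_ite star, star_zero, mul_ite, mul_zero,
    Finset.sum_ite_eq, Finset.mem_univ, if_true, Finset.sum_mul]
  rfl

lemma continuousAt_val_basis {r : RatFunc ℂ} (hnum : 1 ≤ r.num.natDegree)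
    (hdeg : r.denom.natDegree ≤ r.num.natDegree)
    (e : Module.Basis (Fin (deg r)) ℂ (stateSpace r)) {z : ℂ} (hz : IsRegularAt r z)
    (m : Fin (deg r)) : ContinuousAt (val (e m : RatFunc ℂ)) z := by
  obtain ⟨s, -, -, hv, -, -⟩ := exists_basis_numerators hnum hdeg e
  have h1 : ContinuousAt (fun z => (s m).eval z / r.denom.eval z) z :=
    (s m).continuous.continuousAt.div r.denom.continuous.continuousAt hz
  refine h1.congr ?_
  filter_upwards [(isOpen_regular r).mem_nhds hz] with x hx using (hv m x hx).symm

/-- A sesquilinear relation along two fibres over `Ω(r)` forces the matrix to vanish. -/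
lemma eq_zero_of_Z_mul_mul_eq_zero {r : RatFunc ℂ} (hnum : 1 ≤ r.num.natDegree)
    (hdeg : r.denom.natDegree ≤ r.num.natDegree)
    (e : Module.Basis (Fin (deg r)) ℂ (stateSpace r)) {p : ℕ} {u v : ℂ} (hu : u ∈ Omega r)
    (hv : v ∈ Omega r) {M : Matrix (Fin (deg r) × Fin p) (Fin (deg r) × Fin p) ℂ}
    (h : ∀ z ∈ fiber r u, ∀ w ∈ fiber r v, Z e p z * M * (Z e p w)ᴴ = 0) : M = 0 := by
  ext ⟨m, i⟩ ⟨k, j⟩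
  have h1 : ∀ z ∈ fiber r u, (fun k => conj (∑ m, val (e m : RatFunc ℂ) z * M (m, i) (k, j)))
      = 0 := by
    intro z hz
    refine eq_zero_of_sum_val_eq_zero hnum hdeg e hv fun w hw => ?_
    have h2 := congrArg conj (congrFun (congrFun (h z hz w hw) i) j)
    rw [Z_mul_mul_apply] at h2
    simp only [Matrix.zero_apply, map_zero, ← Finset.sum_mul, map_sum (starRingEnd ℂ),
      map_mul (starRingEnd ℂ), Complex.conj_conj] at h2
    simpa only [map_sum, map_mul, mul_comm] using h2
  have h2 := eq_zero_of_sum_val_eq_zero hnum hdeg e hu (g := fun m => M (m, i) (k, j))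
    fun z hz => by
      have := congrFun (h1 z hz) k
      simpa only [Pi.zero_apply, map_eq_zero] using this
  exact congrFun h2 m

/-- The numerator `N` of the kernel, off the fibre of the real point `α`. -/
lemma exists_kernel_numerator {r : RatFunc ℂ} (hnum : 1 ≤ r.num.natDegree)
    (hdeg : r.denom.natDegree ≤ r.num.natDegree)
    (e : Module.Basis (Fin (deg r)) ℂ (stateSpace r)) {p : ℕ} {A B : Set ℂ} (hA : IsOpen A)
    (hB : IsOpen B) (hBA : B ⊆ A)
    {K : preimage r A → preimage r A → Matrix (Fin p) (Fin p) ℂ}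
    (hherm : ∀ z w i j, conj (K z w i j) = K w z j i)
    (hKd : ∀ w j i, DifferentiableOn ℂ (fun z => zeroExt (kernelColumn K w j) z i) (preimage r A))
    (hKinf : ∀ u ∈ B, HasValueAtInfinity r u → ∀ w j i,
      Tendsto (fun z => zeroExt (kernelColumn K w j) z i) (Bornology.cobounded ℂ) (𝓝 0))
    {α : ℂ} (hα : conj α = α) [Fintype (fiber r α)] (hD : fiber r α ⊆ preimage r A)
    (hid : ∀ ζ z : preimage r A, val r ζ ≠ α → val r z ≠ α → ∀ i j,
      (val r ζ - α)⁻¹ * K ζ z i j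
        - ∑ w : fiber r α, (deriv (val r) w * (ζ - w))⁻¹ * K ⟨w, hD w.2⟩ z i j
      = conj (val r z - α)⁻¹ * K ζ z i j
        - ∑ w : fiber r α, conj (deriv (val r) w * (z - w))⁻¹ * K ζ ⟨w, hD w.2⟩ i j) :
    ∃ N : ℂ → Matrix (Fin (deg r) × Fin p) (Fin (deg r) × Fin p) ℂ,
      MatrixAnalyticOn N B ∧ ∀ ζ z : preimage r A, val r ζ ∈ B → val r z ∈ B →
        val r ζ ≠ α → val r z ≠ α →
        (val r ζ - conj (val r z)) • K ζ z =
          Z e p ζ * (N (val r ζ) - (N (val r z))ᴴ) * (Z e p z)ᴴ := by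
  -- The factor r - α is what remains on the columns K(·, w) once the denominators of the resolvent
  -- identity are cleared.
  have hh : ∀ (w : fiber r α) (i j : Fin p), ∃ G : Fin (deg r) → ℂ → ℂ,
      (∀ m, AnalyticOnNhd ℂ (G m) B) ∧ ∀ u ∈ B, ∀ z ∈ fiber r u,
        (val r z - α) * zeroExt (kernelColumn K ⟨w, hD w.2⟩ j) z i =
          ∑ m, val (e m : RatFunc ℂ) z * G m u := by
    intro w i j
    refine exists_coordinates hnum hdeg e (isOpen_preimage (r := r) hA) hB ?_ ?_ ?_
    · refine DifferentiableOn.mul (fun z hz => ?_) (hKd _ j i)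
      exact ((analyticAt_val hz.1).differentiableAt.sub_const α).differentiableWithinAt
    · rintro u hu z ⟨hz, rfl⟩
      exact ⟨hz, hBA hu⟩
    · intro u hu hinf
      have hval := tendsto_val_cobounded hnum hinf
      constructor
      · simpa using (hval.sub_const α).mul (hKinf u hu hinf ⟨w, hD w.2⟩ j i)
      · have h2 : {z | r.denom.eval z = 0}.Finite :=
          r.denom.roots.toFinset.finite_toSet.subset fun z hz => by
            simpa [r.denom_ne_zero] using hz
        filter_upwards [hval (hA.mem_nhds (hBA hu)),
          Bornology.le_cofinite _ h2.compl_mem_cofinite] with z h3 h4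
        exact ⟨h4, h3⟩
  choose G hGa hG using hh
  have hG' : ∀ (w : fiber r α) (i j : Fin p) (z : preimage r A), val r z ∈ B →
      (val r z - α) * K z ⟨w, hD w.2⟩ i j =
        ∑ m, val (e m : RatFunc ℂ) z * G w i j m (val r z) := by
    intro w i j z hz
    rw [← hG w i j _ hz z ⟨z.2.1, rfl⟩, zeroExt_kernelColumn]
  obtain ⟨s, c, -, hv, -, hc⟩ := exists_basis_numerators hnum hdeg e
  -- Coordinates of (r(z) - α)/(r'(w)(z - w)), read off from the Bezoutian at x = w.
  set t : fiber r α → Fin (deg r) → ℂ := fun w m =>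
    (deriv (val r) w)⁻¹ * ((c m).eval (w : ℂ) / r.denom.eval (w : ℂ)) with ht
  have hℓ : ∀ (w : fiber r α) (z : preimage r A), val r z ≠ α →
      (val r z - α) * (deriv (val r) w * (z - w))⁻¹ =
        ∑ m, val (e m : RatFunc ℂ) z * t w m := by
    intro w z hz
    have hqz : r.denom.eval (z : ℂ) ≠ 0 := z.2.1
    have hqw : r.denom.eval (w : ℂ) ≠ 0 := w.2.1
    have hzw : (z : ℂ) - w ≠ 0 := by
      intro h
      apply hz
      rw [sub_eq_zero.mp h, w.2.2]
    have h1 := hc w z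
    have h2 : r.num.eval (w : ℂ) = α * r.denom.eval (w : ℂ) := by
      have := mem_fiber_iff.mp w.2
      rwa [eval_pencil, sub_eq_zero] at this
    have h3 : ∑ m, (s m).eval (z : ℂ) * (c m).eval (w : ℂ) =
        (val r z - α) * r.denom.eval (z : ℂ) * r.denom.eval (w : ℂ) / (z - w) := by
      rw [eq_div_iff hzw, val_eq, sub_mul, div_mul_cancel₀ _ hqz]
      linear_combination h1 - r.denom.eval (z : ℂ) * h2
    calc (val r z - α) * (deriv (val r) w * (z - w))⁻¹
        = (deriv (val r) w)⁻¹ / (r.denom.eval (z : ℂ) * r.denom.eval (w : ℂ)) *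
            ∑ m, (s m).eval (z : ℂ) * (c m).eval (w : ℂ) := by
          rw [h3, mul_inv]
          field_simp
      _ = ∑ m, val (e m : RatFunc ℂ) z * t w m := by
          rw [Finset.mul_sum]
          refine Finset.sum_congr rfl fun m _ => ?_
          rw [hv m z z.2.1, ht]
          field_simp
  refine ⟨fun u => Matrix.of fun a b => ∑ w : fiber r α, G w a.2 b.2 a.1 u * conj (t w b.1),
    fun a b => ?_, fun ζ z hζB hzB hζ hz => ?_⟩
  · refine Finset.analyticOnNhd_fun_sum _ fun w _ => ?_
    exact (hGa w a.2 b.2 a.1).mul analyticOnNhd_const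
  · ext i j
    rw [Z_mul_mul_apply]
    simp only [Matrix.smul_apply, Matrix.sub_apply, Matrix.of_apply, Matrix.conjTranspose_apply,
      smul_eq_mul]
    have hx : val r ζ - α ≠ 0 := sub_ne_zero.mpr hζ
    have hy : conj (val r z - α) ≠ 0 := (_root_.map_ne_zero _).mpr (sub_ne_zero.mpr hz)
    have h1 := hid ζ z hζ hz i j
    have h2 : (val r ζ - conj (val r z)) * K ζ z i j =
        (∑ w : fiber r α, ((val r ζ - α) * K ζ ⟨w, hD w.2⟩ i j) *
            conj ((val r z - α) * (deriv (val r) w * (z - w))⁻¹)) -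
          ∑ w : fiber r α, ((val r ζ - α) * (deriv (val r) w * (ζ - w))⁻¹) *
            conj ((val r z - α) * K z ⟨w, hD w.2⟩ j i) := by
      -- Reality of α makes it cancel from (r(ζ) - α) - conj(r(z) - α).
      have h3 : (val r ζ - conj (val r z)) * K ζ z i j =
          (val r ζ - α) * conj (val r z - α) *
            (conj (val r z - α)⁻¹ * K ζ z i j - (val r ζ - α)⁻¹ * K ζ z i j) := by
        rw [map_inv₀]
        field_simp
        rw [map_sub, hα]
        ring
      have h4 : conj (val r z - α)⁻¹ * K ζ z i j - (val r ζ - α)⁻¹ * K ζ z i j =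
          (∑ w : fiber r α, conj (deriv (val r) w * (z - w))⁻¹ * K ζ ⟨w, hD w.2⟩ i j) -
          ∑ w : fiber r α, (deriv (val r) w * (ζ - w))⁻¹ * K ⟨w, hD w.2⟩ z i j := by
        linear_combination -h1
      rw [h3, h4, mul_sub, Finset.mul_sum, Finset.mul_sum]
      congr 1
      · refine Finset.sum_congr rfl fun w _ => ?_
        rw [map_mul]
        ring
      · refine Finset.sum_congr rfl fun w _ => ?_
        rw [map_mul conj (val r z - α), hherm]
        ring
    rw [h2]
    simp only [hG' _ _ _ _ hζB, hG' _ _ _ _ hzB, hℓ _ _ hζ, hℓ _ _ hz, map_sum, map_mul]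
    simp only [mul_sub, sub_mul, Finset.sum_sub_distrib, Finset.mul_sum, Finset.sum_mul,
      star_sum, star_mul', RCLike.star_def, Complex.conj_conj]
    congr 1
    · rw [Finset.sum_comm]
      refine Finset.sum_congr rfl fun k _ => ?_
      rw [Finset.sum_comm]
      refine Finset.sum_congr rfl fun m _ => Finset.sum_congr rfl fun w _ => by ring
    · rw [Finset.sum_comm]
      refine Finset.sum_congr rfl fun k _ => ?_
      rw [Finset.sum_comm]
      refine Finset.sum_congr rfl fun m _ => Finset.sum_congr rfl fun w _ => by ring

lemma eventually_nhdsNE_val_ne {r : RatFunc ℂ} (hnum : 1 ≤ r.num.natDegree) (α : ℂ) {z : ℂ}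
    (hz : IsRegularAt r z) : ∀ᶠ x in 𝓝[≠] z, val r x ≠ α := by
  filter_upwards [nhdsNE_le_cofinite z (finite_fiber hnum α).compl_mem_cofinite,
    nhdsWithin_le_nhds ((isOpen_regular r).mem_nhds hz)] with x hx hxr hxα
  exact hx ⟨hxr, hxα⟩

lemma continuousAt_sum_val {r : RatFunc ℂ} (hnum : 1 ≤ r.num.natDegree)
    (hdeg : r.denom.natDegree ≤ r.num.natDegree)
    (e : Module.Basis (Fin (deg r)) ℂ (stateSpace r)) {p : ℕ}
    {M : ℂ → Matrix (Fin (deg r) × Fin p) (Fin (deg r) × Fin p) ℂ} {z : ℂ}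
    (hz : IsRegularAt r z) (hM : ∀ a b, ContinuousAt (fun x => M x a b) z) (w : ℂ) (i j : Fin p) :
    ContinuousAt (fun x => (Z e p x * M x * (Z e p w)ᴴ) i j) z := by
  simp only [Z_mul_mul_apply]
  exact tendsto_finsetSum _ fun k _ => tendsto_finsetSum _ fun m _ =>
    ((continuousAt_val_basis hnum hdeg e hz m).mul (hM _ _)).mul continuousAt_const

/-- The kernel identity extends to the fibre of `α` by continuity. -/
lemma kernel_identity_extend {r : RatFunc ℂ} (hnum : 1 ≤ r.num.natDegree)
    (hdeg : r.denom.natDegree ≤ r.num.natDegree)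
    (e : Module.Basis (Fin (deg r)) ℂ (stateSpace r)) {p : ℕ} {A B : Set ℂ}
    (hB : IsOpen B) (hBA : B ⊆ A)
    {K : preimage r A → preimage r A → Matrix (Fin p) (Fin p) ℂ}
    (hherm : ∀ z w i j, conj (K z w i j) = K w z j i)
    (hKc : ∀ w j i, ∀ z ∈ preimage r A,
      ContinuousAt (fun z => zeroExt (kernelColumn K w j) z i) z)
    {N : ℂ → Matrix (Fin (deg r) × Fin p) (Fin (deg r) × Fin p) ℂ} (hN : MatrixAnalyticOn N B)
    {α : ℂ}
    (hid : ∀ ζ z : preimage r A, val r ζ ∈ B → val r z ∈ B → val r ζ ≠ α → val r z ≠ α →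
        (val r ζ - conj (val r z)) • K ζ z =
          Z e p ζ * (N (val r ζ) - (N (val r z))ᴴ) * (Z e p z)ᴴ)
    (ζ z : preimage r A) (hζ : val r ζ ∈ B) (hz : val r z ∈ B) :
    (val r ζ - conj (val r z)) • K ζ z =
      Z e p ζ * (N (val r ζ) - (N (val r z))ᴴ) * (Z e p z)ᴴ := by
  have step : ∀ z : preimage r A, (∀ ζ : preimage r A, val r ζ ∈ B → val r ζ ≠ α →
        (val r ζ - conj (val r z)) • K ζ z =
          Z e p ζ * (N (val r ζ) - (N (val r z))ᴴ) * (Z e p z)ᴴ) →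
      ∀ ζ : preimage r A, val r ζ ∈ B → (val r ζ - conj (val r z)) • K ζ z =
          Z e p ζ * (N (val r ζ) - (N (val r z))ᴴ) * (Z e p z)ᴴ := by
    intro z h ζ hζ
    ext i j
    have h1 : ContinuousAt (fun x => (val r x - conj (val r z)) *
        zeroExt (kernelColumn K z j) x i) ζ :=
      ((continuousAt_val ζ.2.1).sub continuousAt_const).mul (hKc z j i ζ ζ.2)
    have h2 : ContinuousAt (fun x => (Z e p x * (N (val r x) - (N (val r z))ᴴ) *
        (Z e p z)ᴴ) i j) ζ := by
      refine continuousAt_sum_val hnum hdeg e ζ.2.1 (fun a b => ?_) z i j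
      exact ((hN a b _ hζ).continuousAt.comp (continuousAt_val ζ.2.1)).sub continuousAt_const
    have h3 := ((h1.eventuallyEq_nhds_iff_eventuallyEq_nhdsNE h2).mp (by
      filter_upwards [eventually_nhdsNE_val_ne hnum α ζ.2.1,
        nhdsWithin_le_nhds ((isOpen_preimage (r := r) hB).mem_nhds ⟨ζ.2.1, hζ⟩)] with x hx hxB
      have h4 := congrFun (congrFun (h ⟨x, hxB.1, hBA hxB.2⟩ hxB.2 hx) i) j
      rw [Matrix.smul_apply, smul_eq_mul, ← zeroExt_kernelColumn (K := K) z j] at h4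
      exact h4)).self_of_nhds
    simp only [zeroExt_kernelColumn] at h3
    rw [← h3, Matrix.smul_apply, smul_eq_mul]
  -- `step` handles the first variable only; the second is reached by exchanging the roles of `ζ`
  -- and `z` and taking adjoints, since K(z,ζ)^* = K(ζ,z).
  refine step z (fun ζ hζ hζα => ?_) ζ hζ
  have h1 := step ζ (fun z hz hzα => hid z ζ hz hζ hzα hζα) z hz
  have h2 := congrArg Matrix.conjTranspose h1
  have h3 : (K z ζ)ᴴ = K ζ z := by
    ext i j
    rw [Matrix.conjTranspose_apply]
    exact hherm z ζ j i
  rw [Matrix.conjTranspose_smul, h3] at h2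
  simp only [Matrix.conjTranspose_mul, Matrix.conjTranspose_sub,
    Matrix.conjTranspose_conjTranspose, RCLike.star_def, map_sub, Complex.conj_conj] at h2
  rw [← neg_sub, neg_smul, h2, ← neg_sub (N (val r ζ)), Matrix.neg_mul, Matrix.mul_neg, neg_neg,
    Matrix.mul_assoc]

/-- The symmetry `N(u) = N(conj u)^*`. -/
lemma numerator_symm {r : RatFunc ℂ} (hnum : 1 ≤ r.num.natDegree)
    (hdeg : r.denom.natDegree ≤ r.num.natDegree)
    (e : Module.Basis (Fin (deg r)) ℂ (stateSpace r)) {p : ℕ} {A B : Set ℂ}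
    (hB : IsOpen B) (hBA : B ⊆ A)
    {K : preimage r A → preimage r A → Matrix (Fin p) (Fin p) ℂ}
    {N : ℂ → Matrix (Fin (deg r) × Fin p) (Fin (deg r) × Fin p) ℂ} (hN : MatrixAnalyticOn N B)
    (hid : ∀ ζ z : preimage r A, val r ζ ∈ B → val r z ∈ B →
        (val r ζ - conj (val r z)) • K ζ z =
          Z e p ζ * (N (val r ζ) - (N (val r z))ᴴ) * (Z e p z)ᴴ)
    {u : ℂ} (hu : u ∈ B) (hu' : conj u ∈ B) : N u = (N (conj u))ᴴ := by
  have hconj : ∀ u : ℂ, ContinuousAt (fun u : ℂ => conj u) u :=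
    fun u => Complex.continuous_conj.continuousAt
  -- For r(z) = v and r(w) = conj v the left side of `hid` is zero. If both values lie in Ω(r), the
  -- two fibres carry enough points to cancel the factors Z.
  have hgen : ∀ᶠ v in 𝓝[≠] u, N v = (N (conj v))ᴴ := by
    have h1 : ∀ᶠ v in 𝓝[≠] u, conj v ∈ Omega r := by
      have h2 : (conj ⁻¹' (Omega r)ᶜ : Set ℂ).Finite :=
        (finite_compl_Omega hnum hdeg).preimage (starRingEnd ℂ).injective.injOn
      filter_upwards [nhdsNE_le_cofinite u h2.compl_mem_cofinite] with v hv
      by_contra hn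
      exact hv hn
    filter_upwards [h1, eventually_nhdsNE_mem_Omega hnum hdeg u,
      nhdsWithin_le_nhds (hB.mem_nhds hu),
      nhdsWithin_le_nhds ((hconj u).preimage_mem_nhds (hB.mem_nhds hu'))] with v hv1 hv2 hv3 hv4
    refine sub_eq_zero.mp (eq_zero_of_Z_mul_mul_eq_zero hnum hdeg e hv2 hv1 fun z hz w hw => ?_)
    have hv4' : conj v ∈ B := hv4
    have h3 := hid ⟨z, hz.1, by rw [hz.2]; exact hBA hv3⟩
      ⟨w, hw.1, by rw [hw.2]; exact hBA hv4'⟩ (by rw [hz.2]; exact hv3)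
      (by rw [hw.2]; exact hv4')
    simp only [hz.2, hw.2, Complex.conj_conj, sub_self, zero_smul] at h3
    exact h3.symm
  ext a b
  have h1 : ContinuousAt (fun v => N v a b) u := (hN a b u hu).continuousAt
  have h2 : ContinuousAt (fun v => conj (N (conj v) b a)) u :=
    (hconj _).comp ((hN b a _ hu').continuousAt.comp (hconj u))
  refine ((h1.eventuallyEq_nhds_iff_eventuallyEq_nhdsNE h2).mp ?_).self_of_nhds
  filter_upwards [hgen] with v hv
  exact congrFun (congrFun hv a) b

/-- Division of the kernel identity by `r(z) - conj r(w)`. -/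
lemma kernel_eq_of_identity {r : RatFunc ℂ} (hnum : 1 ≤ r.num.natDegree)
    (hdeg : r.denom.natDegree ≤ r.num.natDegree)
    (e : Module.Basis (Fin (deg r)) ℂ (stateSpace r)) {p : ℕ} {A B : Set ℂ}
    (hB : IsOpen B) (hBA : B ⊆ A)
    {K : preimage r A → preimage r A → Matrix (Fin p) (Fin p) ℂ}
    (hKc : ∀ w j i, ∀ z ∈ preimage r A,
      ContinuousAt (fun z => zeroExt (kernelColumn K w j) z i) z)
    {N : ℂ → Matrix (Fin (deg r) × Fin p) (Fin (deg r) × Fin p) ℂ} (hN : MatrixAnalyticOn N B)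
    (hid : ∀ ζ z : preimage r A, val r ζ ∈ B → val r z ∈ B →
        (val r ζ - conj (val r z)) • K ζ z =
          Z e p ζ * (N (val r ζ) - (N (val r z))ᴴ) * (Z e p z)ᴴ)
    (z w : preimage r A) (hz : val r z ∈ B) (hw : val r w ∈ B) :
    K z w = Z e p z * nevanlinnaKernel N (val r z) (val r w) * (Z e p w)ᴴ := by
  by_cases hzw : val r z = conj (val r w)
  · have hconj : conj (val r z) = val r w := by rw [hzw, Complex.conj_conj]
    have hsymm : N (val r z) = (N (val r w))ᴴ := by
      have := numerator_symm hnum hdeg e hB hBA hN hid hz (hconj ▸ hw)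
      rwa [hconj] at this
    rw [nevanlinnaKernel, if_pos hzw]
    ext i j
    set u := val r z with hu
    -- With w fixed, the symmetry turns N(r(w))^* into N(u), so dividing by r(x) - u leaves the
    -- slope of N; as x → z it tends to the derivative.
    set M : ℂ → Matrix (Fin (deg r) × Fin p) (Fin (deg r) × Fin p) ℂ :=
      fun x => Matrix.of fun a b => dslope (fun t => N t a b) u (val r x) with hM
    have h1 : ContinuousAt (fun x => zeroExt (kernelColumn K w j) x i) z := hKc w j i z z.2
    have h2 : ContinuousAt (fun x => (Z e p x * M x * (Z e p w)ᴴ) i j) z := by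
      refine continuousAt_sum_val hnum hdeg e z.2.1 (fun a b => ?_) w i j
      have h3 : ContinuousAt (dslope (fun t => N t a b) u) (val r z) :=
        continuousAt_dslope_same.mpr (hN a b u hz).differentiableAt
      exact h3.comp (continuousAt_val z.2.1)
    have h3 := ((h1.eventuallyEq_nhds_iff_eventuallyEq_nhdsNE h2).mp (by
      filter_upwards [eventually_nhdsNE_val_ne hnum u z.2.1,
        nhdsWithin_le_nhds ((isOpen_preimage (r := r) hB).mem_nhds ⟨z.2.1, hz⟩)] with x hx hxB
      have hx0 : val r x - u ≠ 0 := sub_ne_zero.mpr hx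
      have h4 := hid ⟨x, hxB.1, hBA hxB.2⟩ w hxB.2 hw
      rw [← hzw, ← hsymm] at h4
      have h5 : N (val r x) - N u = (val r x - u) • M x := by
        ext a b
        exact (sub_smul_dslope (fun t => N t a b) u (val r x)).symm
      simp only [h5, Matrix.mul_smul, Matrix.smul_mul] at h4
      have h6 := congrFun (congrFun (smul_right_injective _ hx0 h4) i) j
      rw [← zeroExt_kernelColumn (K := K) w j] at h6
      exact h6)).self_of_nhds
    simp only [zeroExt_kernelColumn] at h3
    rw [h3]
    simp only [hM, ← hu, dslope_same]
  · rw [nevanlinnaKernel, if_neg hzw, Matrix.mul_smul, Matrix.smul_mul, ← hid z w hz hw, smul_smul,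
      inv_mul_cancel₀ (sub_ne_zero.mpr hzw), one_smul]

end RatResolvent

open RatResolvent
-- Assembly of the cases (a) and (b).
theorem theorem10p2
    -- a rational function with non-constant numerator and `deg q ≤ deg p`, and the disks
    (r : RatFunc ℂ) (hnum : 1 ≤ r.num.natDegree) (hdeg : r.denom.natDegree ≤ r.num.natDegree)
    {L : ℕ} (w c : Fin L → ℂ) (R : Fin L → ℝ) (hdisks : AdmissibleDisks r w c R)
    -- a basis of the state space
    (e : Module.Basis (Fin (deg r)) ℂ (stateSpace r))
    -- a reproducing kernel Pontryagin space of analytic functions on `r⁻¹(A(r))`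
    (p : ℕ) (P : Submodule ℂ (preimage r (A r c R) → Fin p → ℂ))
    (form : P →ₗ[ℂ] P →ₗ⋆[ℂ] ℂ)
    (K : preimage r (A r c R) → preimage r (A r c R) → Matrix (Fin p) (Fin p) ℂ)
    (hP : IsPontryaginSpace form) (hK : IsReproducingKernel P form K)
    (hanalytic : ∀ f ∈ P, IsAnalytic f)
    -- resolvent invariance
    (hinv : ∀ α ∈ Omega r ∩ A r c R, ∀ f ∈ P, resolvent r α f ∈ P)
    -- the structure identity
    (hid : ∀ (α : ℂ) (hα : α ∈ Omega r ∩ A r c R) (β : ℂ) (hβ : β ∈ Omega r ∩ A r c R) (f g : P),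
      form f ⟨resolvent r β g.1, hinv β hβ g.1 g.2⟩
        - form ⟨resolvent r α f.1, hinv α hα f.1 f.2⟩ g
        + (α - (starRingEnd ℂ) β) *
          form ⟨resolvent r α f.1, hinv α hα f.1 f.2⟩ ⟨resolvent r β g.1, hinv β hβ g.1 g.2⟩ = 0) :
    ∃ N : ℂ → Matrix (Fin (deg r) × Fin p) (Fin (deg r) × Fin p) ℂ,
      -- in all cases, away from the value `r(∞)` (if it is finite)
      (MatrixAnalyticOn N {u | u ∈ A r c R ∧ ¬ HasValueAtInfinity r u} ∧
        ∀ z w : preimage r (A r c R),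
          ¬ HasValueAtInfinity r (val r z) → ¬ HasValueAtInfinity r (val r w) →
          K z w = Z e p z * nevanlinnaKernel N (val r z) (val r w) * (Z e p w)ᴴ) ∧
      -- on all of `A(r)` and `r⁻¹(A(r))`, unless `r(∞)` is a point of `A(r)` and some element
      -- of the space does not vanish at infinity
      ((∀ b ∈ A r c R, HasValueAtInfinity r b →
          ∀ f ∈ P, Tendsto (zeroExt f) (Bornology.cobounded ℂ) (𝓝 0)) →
        MatrixAnalyticOn N (A r c R) ∧
        ∀ z w : preimage r (A r c R),
          K z w = Z e p z * nevanlinnaKernel N (val r z) (val r w) * (Z e p w)ᴴ) := by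
  obtain ⟨hherm, -⟩ := hP
  have hA := isOpen_A hdisks
  have hDo : IsOpen (preimage r (A r c R)) := isOpen_preimage hA
  obtain ⟨α, hα, hαc⟩ := exists_real_mem_Omega_inter_A hnum hdeg hdisks
  have hD : fiber r α ⊆ preimage r (A r c R) := fun z hz => ⟨hz.1, hz.2.symm ▸ hα.2⟩
  have : Fintype (fiber r α) := hα.1.1.fintype
  have hKid := fun ζ z : preimage r (A r c R) => fun hζ hz => kernel_resolvent_identity hherm hK hD
    (hinv α hα) (fun f g => by
      have := hid α hα α hα f g
      rwa [hαc, sub_self, zero_mul, add_zero, sub_eq_zero] at this) (ζ := ζ) (z := z) hζ hz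
  have hKa : ∀ w j i, AnalyticOnNhd ℂ (fun z => zeroExt (kernelColumn K w j) z i)
      (preimage r (A r c R)) := fun w j i z hz =>
    analyticAt_pi_iff.mp (hanalytic _ (kernelColumn_mem hK w j) z hz) i
  have hsym := kernel_conj hherm hK
  -- Both cases use the same construction: B is A(r), or A(r) with r(∞) removed, where the condition
  -- at infinity is vacuous.
  have main : ∀ B : Set ℂ, IsOpen B → B ⊆ A r c R →
      (∀ u ∈ B, HasValueAtInfinity r u →
        ∀ f ∈ P, Tendsto (zeroExt f) (Bornology.cobounded ℂ) (𝓝 0)) →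
      ∃ N : ℂ → Matrix (Fin (deg r) × Fin p) (Fin (deg r) × Fin p) ℂ,
        MatrixAnalyticOn N B ∧ ∀ z w : preimage r (A r c R), val r z ∈ B → val r w ∈ B →
          K z w = Z e p z * nevanlinnaKernel N (val r z) (val r w) * (Z e p w)ᴴ := by
    intro B hB hBA hinf
    obtain ⟨N, hN, hNid⟩ := exists_kernel_numerator hnum hdeg e hA hB hBA hsym
      (fun w j i => (hKa w j i).differentiableOn)
      (fun u hu hui w j i =>
        tendsto_pi_nhds.mp (hinf u hu hui _ (kernelColumn_mem hK w j)) i) hαc hD hKid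
    have hKc : ∀ w j i, ∀ z ∈ preimage r (A r c R),
        ContinuousAt (fun z => zeroExt (kernelColumn K w j) z i) z :=
      fun w j i z hz => (hKa w j i z hz).continuousAt
    exact ⟨N, hN, kernel_eq_of_identity hnum hdeg e hB hBA hKc hN
      (kernel_identity_extend hnum hdeg e hB hBA hsym hKc hN hNid)⟩
  -- The three alternatives of (a) in one condition: it is vacuous if r(∞) is infinite or lies
  -- outside A(r).
  by_cases hinf : ∀ b ∈ A r c R, HasValueAtInfinity r b →
      ∀ f ∈ P, Tendsto (zeroExt f) (Bornology.cobounded ℂ) (𝓝 0)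
  · obtain ⟨N, hN, hNK⟩ := main _ hA subset_rfl hinf
    exact ⟨N, ⟨fun i j u hu => hN i j u hu.1, fun z w _ _ => hNK z w z.2.2 w.2.2⟩,
      fun _ => ⟨hN, fun z w => hNK z w z.2.2 w.2.2⟩⟩
  · obtain ⟨N, hN, hNK⟩ := main {u | u ∈ A r c R ∧ ¬ HasValueAtInfinity r u}
      (hA.inter (setOf_hasValueAtInfinity_finite r).isClosed.isOpen_compl) (fun u hu => hu.1)
      (fun u hu hui => absurd hui hu.2)
    exact ⟨N, ⟨hN, fun z w hz hw => hNK z w ⟨z.2.2, hz⟩ ⟨w.2.2, hw⟩⟩, fun h => absurd h hinf⟩
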